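/- Let $G$ be a finite group, let $k\ge 1$ be an integer and let $\emptyset\neq A\subseteq G$. For $1\le i\le k+1$ put $V_i=\{i\}\times G$, and let $Y_{G,k}=V_1*\cdots*V_{k+1}$ be the simplicial join of these discrete sets, i.e. the complex whose simplices are the sets containing at most one vertex of each $V_i$. The balanced Cayley complex $Y_{A,k}$ is the subcomplex of $Y_{G,k}$ that contains all simplices of $Y_{G,k}$ of dimension at most $k-1$, and whose $k$-simplices are the sets $\{(1,y_1),\ldots,(k+1,y_{k+1})\}$ with $y_1y_2\cdots y_{k+1}\in A$. For a finite simplicial complex $X$ let $C^j(X)$ be the space of real (skew-symmetric) simplicial $j$-cochains, with $C^{-1}(X)=\mathbb{R}$, let $d_j:C^j(X)\to C^{j+1}(X)$, $d_j\phi(\sigma)=\sum_{i}(-1)^i\phi(\sigma_i)$, be the coboundary operator (with $d_{-1}(a)(v)=a$), and let $d_j^*$ be its adjoint with respect to the inner products $(\phi,\psi)=\sum_{\sigma}\phi(\sigma)\psi(\sigma)$, where $\sigma$ runs over the $j$-simplices, each taken with one fixed orientation. The $j$-th spectral gap $\mu_j(X)$, $j\ge 0$, is the minimal eigenvalue of the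 reduced Laplacian $L_j=d_{j-1}d_{j-1}^*+d_j^*d_j$ on $C^j(X)$. Let $$\nu(A)=\max_{\rho}\Big\|\sum_{a\in A}\rho(a)\Big\|,$$ where $\rho$ runs over the nontrivial irreducible unitary representations $\rho:G\to U(d_\rho)$ of $G$ and $\|\cdot\|$ is the spectral norm of a complex matrix; if $G$ is the trivial group (so that there is no such $\rho$), put $\nu(A)=0$. Then $$\mu_{k-1}(Y_{A,k})\ \ge\ |A|-k\cdot\nu(A).$$ -/

import Mathlib

noncomputable section

namespace CayleyComplex

/-! ## Real simplicial cochains of a finite simplicial complex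

The faces of a `PreAbstractSimplicialComplex` are its nonempty simplices. The empty simplex, of
dimension `-1`, is added by hand. Simplices and cochains are indexed by the number `m` of vertices,
so that index `m` stands for dimension `m - 1`. -/

section Cochains

variable {V : Type*}

/-- Ordered simplices `[v_0, …, v_{m-1}]` of `X` with `m` distinct vertices, that is, of dimension
`m - 1`; for `m = 0` there is exactly one, the empty simplex. -/
def OrderedSimplex (X : PreAbstractSimplicialComplex V) (m : ℕ) : Type _ :=
  {v : Fin m ↪ V // m = 0 ∨ Finset.univ.map v ∈ X.faces}

/-- Simplices of `X` with `m` vertices, that is, of dimension `m - 1`. -/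
def Simplex (X : PreAbstractSimplicialComplex V) (m : ℕ) : Type _ :=
  {s : Finset V // s.card = m ∧ (m = 0 ∨ s ∈ X.faces)}

variable {X : PreAbstractSimplicialComplex V} {m : ℕ}

/-- Reorder the vertices of an ordered simplex. -/
def OrderedSimplex.reorder (σ : OrderedSimplex X m) (π : Equiv.Perm (Fin m)) :
    OrderedSimplex X m :=
  ⟨π.toEmbedding.trans σ.1, by
    rw [← Finset.map_map, Finset.map_univ_equiv]
    exact σ.2⟩

/-- The `i`-th face of an ordered simplex: delete the vertex `v_i`. -/
def OrderedSimplex.face (σ : OrderedSimplex X (m + 1)) (i : Fin (m + 1)) : OrderedSimplex X m :=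
  ⟨i.succAboveEmb.trans σ.1, by
    rcases Nat.eq_zero_or_pos m with h | h
    · exact Or.inl h
    · right
      have h1 : Finset.univ.map σ.1 ∈ X.faces := σ.2.resolve_left (Nat.succ_ne_zero m)
      refine (X.isRelLowerSet_faces h1).2 ?_ ?_
      · rw [← Finset.map_map]
        exact Finset.map_subset_map.2 (Finset.subset_univ _)
      · have : Nonempty (Fin m) := ⟨⟨0, h⟩⟩
        exact Finset.univ_nonempty.map⟩

/-- A simplex taken with an arbitrary but fixed orientation. -/
def Simplex.orient (s : Simplex X m) : OrderedSimplex X m :=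
  ⟨(s.1.equivFinOfCardEq s.2.1).symm.toEmbedding.trans (Function.Embedding.subtype _), by
    have h : Finset.univ.map ((s.1.equivFinOfCardEq s.2.1).symm.toEmbedding.trans
        (Function.Embedding.subtype (· ∈ s.1))) = s.1 := by
      rw [← Finset.map_map, Finset.map_univ_equiv]
      ext x
      simp
    rw [h]
    exact s.2.2⟩

/-- The skew-symmetric real functions on ordered simplices with `m` vertices. -/
def cochainSubmodule (X : PreAbstractSimplicialComplex V) (m : ℕ) :
    Submodule ℝ (OrderedSimplex X m → ℝ) where
  carrier := {φ | ∀ σ π, φ (σ.reorder π) = (Equiv.Perm.sign π : ℤ) * φ σ}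
  add_mem' := by
    intro a b ha hb σ π
    simp only [Pi.add_apply, ha σ π, hb σ π]
    ring
  zero_mem' := by
    intro σ π
    simp
  smul_mem' := by
    intro c a ha σ π
    simp only [Pi.smul_apply, smul_eq_mul, ha σ π]
    ring

/-- `Cochain X m` is the space `C^{m-1}(X)` of real `(m-1)`-cochains; in particular
`Cochain X 0 = C^{-1}(X)` is one-dimensional. -/
def Cochain (X : PreAbstractSimplicialComplex V) (m : ℕ) : Type _ :=
  cochainSubmodule X m

instance : AddCommGroup (Cochain X m) := inferInstanceAs (AddCommGroup (cochainSubmodule X m))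

instance : Module ℝ (Cochain X m) := inferInstanceAs (Module ℝ (cochainSubmodule X m))

instance : CoeFun (Cochain X m) (fun _ => OrderedSimplex X m → ℝ) := ⟨fun φ => φ.1⟩

theorem Cochain.ext {φ ψ : Cochain X m} (h : ∀ σ, φ σ = ψ σ) : φ = ψ :=
  Subtype.ext (funext h)

theorem face_reorder (σ : OrderedSimplex X (m + 1)) (π : Equiv.Perm (Fin (m + 1)))
    (i : Fin (m + 1)) : ∃ π' : Equiv.Perm (Fin m),
      (σ.reorder π).face i = (σ.face (π i)).reorder π' ∧
      (-1 : ℤ) ^ (i : ℕ) * (Equiv.Perm.sign π' : ℤ) =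
        (Equiv.Perm.sign π : ℤ) * (-1 : ℤ) ^ ((π i : Fin (m + 1)) : ℕ) := by
  obtain ⟨⟨p, π'⟩, hπ'⟩ :=
    Equiv.Perm.decomposeFin.symm.surjective ((π i).cycleRange * π * i.cycleRange⁻¹)
  have h0 : p = 0 := by
    have h := congrArg (fun f : Equiv.Perm (Fin (m + 1)) => f 0) hπ'
    simpa [Equiv.Perm.mul_apply, Equiv.Perm.inv_def, Fin.cycleRange_symm_zero,
      Fin.cycleRange_self] using h
  subst h0
  refine ⟨π', ?_, ?_⟩
  · apply Subtype.ext
    ext j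
    change σ.1 (π (i.succAbove j)) = σ.1 ((π i).succAbove (π' j))
    congr 1
    have h := congrArg (fun f : Equiv.Perm (Fin (m + 1)) => (π i).cycleRange.symm (f j.succ)) hπ'
    simp only [Equiv.Perm.mul_apply, Equiv.Perm.inv_def, Fin.cycleRange_symm_succ,
      Equiv.symm_apply_apply, Equiv.Perm.decomposeFin_symm_apply_succ, Equiv.swap_self,
      Equiv.refl_apply] at h
    exact h.symm
  · have h := congrArg (fun f : Equiv.Perm (Fin (m + 1)) => (Equiv.Perm.sign f : ℤ)) hπ'
    simp only [Equiv.Perm.sign_mul, Equiv.Perm.sign_inv, Fin.sign_cycleRange,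
      Equiv.Perm.decomposeFin.symm_sign, Units.val_mul, Units.val_pow_eq_pow_val,
      Units.val_neg, Units.val_one, if_true, one_mul] at h
    rw [h]
    have h2 : ((-1 : ℤ) ^ (i : ℕ)) * (-1 : ℤ) ^ (i : ℕ) = 1 := by
      rw [← mul_pow]; simp
    linear_combination ((-1 : ℤ) ^ ((π i : Fin (m + 1)) : ℕ) * (Equiv.Perm.sign π : ℤ)) * h2

/-- The coboundary operator, `(d φ)(σ) = ∑ i, (-1)^i φ(σ_i)`. It maps `C^{m-1}` to `C^m`, and for
`m = 0` it is the augmentation `(d a)(v) = a`. -/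
def coboundary (X : PreAbstractSimplicialComplex V) (m : ℕ) :
    Cochain X m →ₗ[ℝ] Cochain X (m + 1) where
  toFun φ := ⟨fun σ => ∑ i : Fin (m + 1), (-1 : ℝ) ^ (i : ℕ) * φ (σ.face i), by
    intro σ π
    change ∑ i : Fin (m + 1), (-1 : ℝ) ^ (i : ℕ) * φ ((σ.reorder π).face i) =
      (Equiv.Perm.sign π : ℤ) * ∑ i : Fin (m + 1), (-1 : ℝ) ^ (i : ℕ) * φ (σ.face i)
    rw [Finset.mul_sum,
      ← Equiv.sum_comp π (fun i => ((Equiv.Perm.sign π : ℤ) : ℝ) * ((-1 : ℝ) ^ (i : ℕ) *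
        φ (σ.face i)))]
    refine Finset.sum_congr rfl fun i _ => ?_
    obtain ⟨π', h1, h2⟩ := face_reorder σ π i
    rw [h1, φ.2 _ π']
    have h3 : (-1 : ℝ) ^ (i : ℕ) * ((Equiv.Perm.sign π' : ℤ) : ℝ) =
        ((Equiv.Perm.sign π : ℤ) : ℝ) * (-1 : ℝ) ^ ((π i : Fin (m + 1)) : ℕ) := by
      exact_mod_cast h2
    linear_combination φ.1 (σ.face (π i)) * h3⟩
  map_add' φ ψ := by
    apply Cochain.ext
    intro σ
    change ∑ i : Fin (m + 1), (-1 : ℝ) ^ (i : ℕ) * (φ.1 (σ.face i) + ψ.1 (σ.face i)) =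
      ∑ i : Fin (m + 1), (-1 : ℝ) ^ (i : ℕ) * φ.1 (σ.face i) +
      ∑ i : Fin (m + 1), (-1 : ℝ) ^ (i : ℕ) * ψ.1 (σ.face i)
    rw [← Finset.sum_add_distrib]
    exact Finset.sum_congr rfl fun i _ => by ring
  map_smul' c φ := by
    apply Cochain.ext
    intro σ
    change ∑ i : Fin (m + 1), (-1 : ℝ) ^ (i : ℕ) * (c * φ.1 (σ.face i)) =
      c * ∑ i : Fin (m + 1), (-1 : ℝ) ^ (i : ℕ) * φ.1 (σ.face i)
    rw [Finset.mul_sum]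
    exact Finset.sum_congr rfl fun i _ => by ring

theorem exists_reorder_orient (σ : OrderedSimplex X m) :
    ∃ (s : Simplex X m) (π : Equiv.Perm (Fin m)), σ = s.orient.reorder π := by
  let s : Simplex X m := ⟨Finset.univ.map σ.1, by simp, σ.2⟩
  have hmem : ∀ i, σ.1 i ∈ s.1 := fun i => Finset.mem_map_of_mem _ (Finset.mem_univ i)
  let f : Fin m → Fin m := fun i => s.1.equivFinOfCardEq s.2.1 ⟨σ.1 i, hmem i⟩
  have hf : Function.Injective f := by
    intro i j h
    have h' := (s.1.equivFinOfCardEq s.2.1).injective h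
    exact σ.1.injective (congrArg Subtype.val h')
  refine ⟨s, Equiv.ofBijective f (Finite.injective_iff_bijective.1 hf), ?_⟩
  apply Subtype.ext
  ext i
  change σ.1 i = ((s.1.equivFinOfCardEq s.2.1).symm (f i)).1
  simp [f]

variable [Fintype V]

instance : Finite (OrderedSimplex X m) :=
  inferInstanceAs (Finite {v : Fin m ↪ V // m = 0 ∨ Finset.univ.map v ∈ X.faces})

instance : Finite (Simplex X m) :=
  inferInstanceAs (Finite {s : Finset V // s.card = m ∧ (m = 0 ∨ s ∈ X.faces)})

instance : Fintype (Simplex X m) := Fintype.ofFinite _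

instance : FiniteDimensional ℝ (Cochain X m) :=
  inferInstanceAs (FiniteDimensional ℝ (cochainSubmodule X m))

/-- The standard inner product `(φ, ψ) = ∑ φ(s) ψ(s)`, the sum over all simplices `s` with `m`
vertices, each taken with its fixed orientation. -/
@[reducible]
def cochainCore (X : PreAbstractSimplicialComplex V) (m : ℕ) :
    InnerProductSpace.Core ℝ (Cochain X m) where
  inner φ ψ := ∑ s : Simplex X m, φ s.orient * ψ s.orient
  conj_inner_symm φ ψ := by
    change ∑ s : Simplex X m, ψ s.orient * φ s.orient = ∑ s : Simplex X m, φ s.orient * ψ s.orient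
    exact Finset.sum_congr rfl fun s _ => mul_comm _ _
  re_inner_nonneg φ := by
    change 0 ≤ ∑ s : Simplex X m, φ s.orient * φ s.orient
    exact Finset.sum_nonneg fun s _ => mul_self_nonneg _
  add_left φ ψ χ := by
    change ∑ s : Simplex X m, (φ s.orient + ψ s.orient) * χ s.orient =
      ∑ s : Simplex X m, φ s.orient * χ s.orient + ∑ s : Simplex X m, ψ s.orient * χ s.orient
    rw [← Finset.sum_add_distrib]
    exact Finset.sum_congr rfl fun s _ => add_mul _ _ _
  smul_left φ ψ r := by
    change ∑ s : Simplex X m, (r * φ s.orient) * ψ s.orient =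
      r * ∑ s : Simplex X m, φ s.orient * ψ s.orient
    rw [Finset.mul_sum]
    exact Finset.sum_congr rfl fun s _ => mul_assoc _ _ _
  definite φ h := by
    change ∑ s : Simplex X m, φ s.orient * φ s.orient = 0 at h
    rw [Finset.sum_eq_zero_iff_of_nonneg fun s _ => mul_self_nonneg _] at h
    apply Cochain.ext
    intro σ
    obtain ⟨s, π, rfl⟩ := exists_reorder_orient σ
    rw [φ.2 s.orient π, mul_self_eq_zero.1 (h s (Finset.mem_univ s)), mul_zero]
    rfl

instance : NormedAddCommGroup (Cochain X m) :=
  @InnerProductSpace.Core.toNormedAddCommGroup ℝ (Cochain X m) _ _ _ (cochainCore X m)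

instance : InnerProductSpace ℝ (Cochain X m) :=
  InnerProductSpace.ofCore (cochainCore X m).toCore

/-- The reduced `j`-th Laplacian `L_j = d_{j-1} d_{j-1}^* + d_j^* d_j` on `C^j(X)`, `j ≥ 0`. -/
def laplacian (X : PreAbstractSimplicialComplex V) (j : ℕ) : Module.End ℝ (Cochain X (j + 1)) :=
  coboundary X j ∘ₗ LinearMap.adjoint (coboundary X j) +
    LinearMap.adjoint (coboundary X (j + 1)) ∘ₗ coboundary X (j + 1)

/-- The `j`-th spectral gap `μ_j(X)`: the minimal eigenvalue of `L_j`. -/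
def spectralGap (X : PreAbstractSimplicialComplex V) (j : ℕ) : ℝ :=
  sInf {t : ℝ | Module.End.HasEigenvalue (laplacian X j) t}

/-- The infimum in `spectralGap` is a minimum as soon as `C^j(X)` is nonzero. -/
theorem spectralGap_isLeast (X : PreAbstractSimplicialComplex V) (j : ℕ)
    [Nontrivial (Cochain X (j + 1))] :
    IsLeast {t : ℝ | Module.End.HasEigenvalue (laplacian X j) t} (spectralGap X j) := by
  have hsymm : (laplacian X j).IsSymmetric := by
    intro φ ψ
    simp only [laplacian, LinearMap.add_apply, LinearMap.comp_apply, inner_add_left,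
      inner_add_right, LinearMap.adjoint_inner_left (coboundary X (j + 1)),
      LinearMap.adjoint_inner_right (coboundary X (j + 1))]
    rw [← LinearMap.adjoint_inner_right (coboundary X j),
      ← LinearMap.adjoint_inner_left (coboundary X j)]
  have hne : {t : ℝ | Module.End.HasEigenvalue (laplacian X j) t}.Nonempty :=
    ⟨_, hsymm.hasEigenvalue_iInf_of_finiteDimensional⟩
  have hfin : {t : ℝ | Module.End.HasEigenvalue (laplacian X j) t}.Finite :=
    Module.End.finite_hasEigenvalue _
  exact ⟨hne.csInf_mem hfin, fun t ht => csInf_le hfin.bddBelow ht⟩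

end Cochains

/-! ## Balanced Cayley complexes -/

section Cayley

variable (G : Type*)

/-- The join `Y_{G,k} = V_1 * ⋯ * V_{k+1}` of the discrete sets `V_i = {i} × G`: its simplices are
the nonempty sets that contain at most one vertex of each `V_i`. The index `i` runs over
`Fin (k + 1)`, that is, over `0, …, k`. -/
def balancedJoin (k : ℕ) : PreAbstractSimplicialComplex (Fin (k + 1) × G) where
  faces := {s | s.Nonempty ∧ Set.InjOn Prod.fst (s : Set (Fin (k + 1) × G))}
  isRelLowerSet_faces := by
    rintro s ⟨h1, h2⟩
    exact ⟨h1, fun t hts ht => ⟨ht, h2.mono (Finset.coe_subset.2 hts)⟩⟩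

variable {G} [Group G]

/-- The balanced Cayley complex `Y_{A,k}`: the simplices of `Y_{G,k}` that have dimension at most
`k - 1` (at most `k` vertices), or that are of the form `{(0, y_0), …, (k, y_k)}` with
`y_0 y_1 ⋯ y_k ∈ A` (product in this order). -/
def cayleyComplex (A : Finset G) (k : ℕ) : PreAbstractSimplicialComplex (Fin (k + 1) × G) where
  faces := {s | s ∈ (balancedJoin G k).faces ∧ (s.card ≤ k ∨
    ∃ y : Fin (k + 1) → G, (List.ofFn y).prod ∈ A ∧
      (s : Set (Fin (k + 1) × G)) = Set.range fun i => (i, y i))}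
  isRelLowerSet_faces := by
    rintro s ⟨h1, h2⟩
    refine ⟨h1.1, fun t hts ht => ⟨((balancedJoin G k).isRelLowerSet_faces h1).2 hts ht, ?_⟩⟩
    rcases hts.eq_or_ssubset with rfl | hss
    · exact h2
    · left
      have hlt : t.card < s.card := Finset.card_lt_card hss
      rcases h2 with h | ⟨y, -, hy⟩
      · omega
      · have hs : s.card = k + 1 := by
          rw [← Set.ncard_coe_finset, hy, Set.ncard_range_of_injective
            (fun i j hij => congrArg Prod.fst hij), Nat.card_eq_fintype_card, Fintype.card_fin]
        omega

/-! ## Unitary representations and the quantity `ν(A)` -/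

/-- The linear representation on `ℂ^d` given by a homomorphism `ρ : G → U(d)`. -/
def toRepresentation {d : ℕ} (ρ : G →* Matrix.unitaryGroup (Fin d) ℂ) :
    Representation ℂ G (Fin d → ℂ) :=
  (Matrix.toLinAlgEquiv' : Matrix (Fin d) (Fin d) ℂ ≃ₐ[ℂ] _).toMonoidHom.comp
    ((Matrix.unitaryGroup (Fin d) ℂ).subtype.comp ρ)

/-- The Fourier coefficient `∑_{a ∈ A} ρ(a)` of the indicator function of `A`. -/
def fourierCoeff (A : Finset G) {d : ℕ} (ρ : G →* Matrix.unitaryGroup (Fin d) ℂ) :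
    Matrix (Fin d) (Fin d) ℂ :=
  ∑ a ∈ A, (ρ a : Matrix (Fin d) (Fin d) ℂ)

/-- The spectral norms of the Fourier coefficients of `A` at the nontrivial irreducible unitary
representations of `G`. (An irreducible `ρ` is the trivial representation iff `ρ = 1`.) -/
def fourierNorms (A : Finset G) : Set ℝ :=
  {r | ∃ (d : ℕ) (ρ : G →* Matrix.unitaryGroup (Fin d) ℂ),
    (toRepresentation ρ).IsIrreducible ∧ ρ ≠ 1 ∧
    r = ‖Matrix.toEuclideanCLM (n := Fin d) (𝕜 := ℂ) (fourierCoeff A ρ)‖}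

/-- `ν(A)`, the largest spectral norm of a Fourier coefficient of `A` at a nontrivial irreducible
unitary representation; it is `0` when `G` is trivial and there is no such representation. -/
def nu (A : Finset G) : ℝ := sSup (fourierNorms A)

theorem fourierNorms_bddAbove (A : Finset G) : BddAbove (fourierNorms A) := by
  refine ⟨A.card, ?_⟩
  rintro r ⟨d, ρ, -, -, rfl⟩
  rw [fourierCoeff, map_sum]
  refine (norm_sum_le _ _).trans ?_
  rw [Finset.card_eq_sum_ones, Nat.cast_sum]
  refine Finset.sum_le_sum fun a _ => ?_
  rw [Nat.cast_one]
  have h : Matrix.toEuclideanCLM (n := Fin d) (𝕜 := ℂ) (ρ a : Matrix (Fin d) (Fin d) ℂ) ∈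
      unitary _ := Unitary.map_mem _ (ρ a).2
  have h1 := CStarRing.norm_mem_unitary_mul (1 : EuclideanSpace ℂ (Fin d) →L[ℂ] _) h
  rw [mul_one] at h1
  rw [h1]
  exact ContinuousLinearMap.norm_id_le

end Cayley

end CayleyComplex

end

/-!
For a cochain `φ` of dimension `k - 1` write `φ_p` for its restriction to the simplices that miss
the color `p`, a function on `G ^ k`. The quadratic form of the Laplacian is `‖dφ‖² + ‖d*φ‖²`, and
an eigenvector `φ` for the spectral gap reduces the theorem to bounding this form from below by
`(|A| - k ν(A)) ‖φ‖²` (`le_spectralGap_of_forall`).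

Each `(k-1)`-simplex lies in exactly `|A|` top simplices, so the diagonal terms of `‖dφ‖²` add up to
`|A| ‖φ‖²`. The remaining terms are split into blocks, indexed by pairs of colors `p < q` and group
elements `w` on the other colors. With `p` and `q` free, `φ_q` and `φ_p` become functions `f`, `h`
on `G`, and the contribution of the block is
`-2 ε ∑_{a, b} [P a Q b R ∈ A] f a h b + (∑ f + ε ∑ h)²` with a sign `ε`, where the
first term comes from `dφ` and the square is the squared value of `d*φ` at the simplex given by `w`.
Splitting `h` into its mean and a function `h₀` of sum zero, the mean part of the bilinear form is
absorbed by the square since `|A| ≤ |G|` (`neg_nu_mul_le_of_mul`). The part with `h₀` is at most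
`ν(A) ‖f‖ ‖h₀‖`, because `∑_{a ∈ A} U a` has norm at most `ν(A)` on the functions of sum zero, the
sum of the nontrivial irreducible constituents of the regular representation `U`
(`norm_sum_le_nu_mul`). Hence each block contributes at least `-ν(A) (‖f‖² + ‖h‖²)`; as every color
lies in `k` pairs, these bounds add up to `-k ν(A) ‖φ‖²` (`card_sub_nu_mul_le`).

The translation between cochains and functions on tuples rests on the fact that the inner product of
cochains is `1 / m!` times the sum over all ordered simplices with `m` vertices
(`factorial_mul_inner`). It makes the choice of orientations irrelevant and shows that the adjoint of
`d` sums over all ways to put a vertex in front of a simplex (`adjoint_coboundary_apply`).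
-/

namespace CayleyComplex

/-! ### Fourier bounds for unitary representations -/

section Fourier

variable {G : Type*} [Group G]

theorem nu_nonneg (A : Finset G) : 0 ≤ nu A := by
  refine Real.sSup_nonneg ?_
  rintro r ⟨d, ρ, -, -, rfl⟩
  exact norm_nonneg _

/-- A unitary action on `ℂ^d` is given by a homomorphism to the unitary matrices. -/
theorem exists_unitaryGroup_hom {d : ℕ}
    (V : G →* (EuclideanSpace ℂ (Fin d) ≃ₗᵢ[ℂ] EuclideanSpace ℂ (Fin d))) :
    ∃ ρ : G →* Matrix.unitaryGroup (Fin d) ℂ, ∀ g,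
      Matrix.toEuclideanCLM (n := Fin d) (𝕜 := ℂ) (ρ g : Matrix (Fin d) (Fin d) ℂ) =
        ((V g : EuclideanSpace ℂ (Fin d) ≃L[ℂ] EuclideanSpace ℂ (Fin d)) :
          EuclideanSpace ℂ (Fin d) →L[ℂ] EuclideanSpace ℂ (Fin d)) := by
  let T : (EuclideanSpace ℂ (Fin d) →L[ℂ] EuclideanSpace ℂ (Fin d)) ≃⋆ₐ[ℂ]
      Matrix (Fin d) (Fin d) ℂ :=
    (Matrix.toEuclideanCLM (n := Fin d) (𝕜 := ℂ)).symm
  let u : G →* unitary (EuclideanSpace ℂ (Fin d) →L[ℂ] EuclideanSpace ℂ (Fin d)) :=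
    (Unitary.linearIsometryEquiv (𝕜 := ℂ) (H := EuclideanSpace ℂ (Fin d))).symm.toMonoidHom.comp V
  refine ⟨{ toFun := fun g => ⟨T (u g), Unitary.map_mem T (u g).2⟩
            map_one' := Subtype.ext (by simp)
            map_mul' := fun g h => Subtype.ext (by simp) }, fun g => ?_⟩
  exact (Matrix.toEuclideanCLM (n := Fin d) (𝕜 := ℂ)).apply_symm_apply _

variable {E : Type*} [NormedAddCommGroup E] [InnerProductSpace ℂ E]

/-- The restriction of a unitary representation to an invariant subspace. -/
def restrictUnitary (U : G →* (E ≃ₗᵢ[ℂ] E)) (M : Submodule ℂ E)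
    (hM : ∀ g, ∀ w ∈ M, U g w ∈ M) : G →* (M ≃ₗᵢ[ℂ] M) where
  toFun g :=
    { toFun := fun w => ⟨U g w, hM g w w.2⟩
      invFun := fun w => ⟨U g⁻¹ w, hM g⁻¹ w w.2⟩
      map_add' := fun v w => Subtype.ext (map_add (U g) _ _)
      map_smul' := fun c w => Subtype.ext (map_smul (U g) _ _)
      left_inv := fun w => Subtype.ext (by
        change (U g⁻¹ * U g) w = w
        rw [← map_mul, inv_mul_cancel, map_one]; rfl)
      right_inv := fun w => Subtype.ext (by
        change (U g * U g⁻¹) w = w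
        rw [← map_mul, mul_inv_cancel, map_one]; rfl)
      norm_map' := fun w => (U g).norm_map w }
  map_one' := by
    ext w
    change (U 1) (w : E) = w
    rw [map_one]; rfl
  map_mul' g h := by
    ext w
    change (U (g * h)) (w : E) = U g (U h w)
    rw [map_mul]; rfl

/-- On an irreducible invariant subspace without fixed vectors, an orthonormal basis turns the
action into one of the representations over which `nu` is the supremum. -/
theorem norm_sum_le_of_minimal [FiniteDimensional ℂ E] (U : G →* (E ≃ₗᵢ[ℂ] E))
    (A : Finset G) (M : Submodule ℂ E) (hM : ∀ g, ∀ w ∈ M, U g w ∈ M) (hbot : M ≠ ⊥)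
    (hmin : ∀ N ≤ M, (∀ g, ∀ w ∈ N, U g w ∈ N) → N = ⊥ ∨ N = M)
    (hfix : ∀ w ∈ M, (∀ g, U g w = w) → w = 0) (w : E) (hw : w ∈ M) :
    ‖∑ a ∈ A, U a w‖ ≤ nu A * ‖w‖ := by
  let e := (stdOrthonormalBasis ℂ M).repr
  let R := restrictUnitary U M hM
  let V : G →* (EuclideanSpace ℂ (Fin (Module.finrank ℂ M)) ≃ₗᵢ[ℂ]
      EuclideanSpace ℂ (Fin (Module.finrank ℂ M))) :=
    { toFun := fun g => (e.symm.trans (R g)).trans e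
      map_one' := by ext1 x; simp
      map_mul' := fun g h => by
        ext1 x
        change e (R (g * h) (e.symm x)) = e (R g (e.symm (e (R h (e.symm x)))))
        rw [map_mul, LinearIsometryEquiv.symm_apply_apply]
        rfl }
  obtain ⟨ρ, hρ⟩ := exists_unitaryGroup_hom V
  -- the action of `ρ g` in coordinates
  have hρV : ∀ g (v : M), (ρ g : Matrix _ _ ℂ).mulVec (e v).ofLp = (e (R g v)).ofLp := by
    intro g v
    have h1 := congrArg (fun T => (T (e v)).ofLp) (hρ g)
    have h2 : V g (e v) = e (R g v) := by
      change e (R g (e.symm (e v))) = _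
      rw [LinearIsometryEquiv.symm_apply_apply]
    change _ = (V g (e v)).ofLp at h1
    rw [h2] at h1
    exact h1
  have hne : ρ ≠ 1 := by
    rintro rfl
    obtain ⟨v, hv, hv0⟩ := Submodule.exists_mem_ne_zero_of_ne_bot hbot
    refine hv0 (hfix v hv fun g => ?_)
    have h := hρV g ⟨v, hv⟩
    simp only [MonoidHom.one_apply, OneMemClass.coe_one, Matrix.one_mulVec] at h
    have h' := e.injective ((WithLp.ofLp_injective 2) h)
    exact (congrArg Subtype.val h').symm
  have hirr : (toRepresentation ρ).IsIrreducible := by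
    let c : M ≃ₗ[ℂ] (Fin (Module.finrank ℂ M) → ℂ) :=
      e.toLinearEquiv.trans (WithLp.linearEquiv 2 ℂ _)
    have hc : ∀ g (v : M), toRepresentation ρ g (c v) = c (R g v) := fun g v => hρV g v
    have hnt : Nontrivial M := Submodule.nontrivial_iff_ne_bot.2 hbot
    refine { exists_pair_ne := ⟨⊥, ⊤, fun h => ?_⟩, eq_bot_or_eq_top := fun N => ?_ }
    · have h' : (⊥ : Submodule ℂ (Fin (Module.finrank ℂ M) → ℂ)) = ⊤ :=
        congrArg Subrepresentation.toSubmodule h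
      have : Nontrivial (Fin (Module.finrank ℂ M) → ℂ) := c.symm.toEquiv.nontrivial
      exact bot_ne_top h'
    · have h := hmin ((N.toSubmodule.comap c.toLinearMap).map M.subtype)
        (Submodule.map_subtype_le _ _) (by
          rintro g _ ⟨v, hv, rfl⟩
          refine ⟨R g v, ?_, rfl⟩
          change c (R g v) ∈ N.toSubmodule
          rw [← hc]
          exact N.apply_mem_toSubmodule g hv)
      refine h.imp (fun h => ?_) (fun h => ?_)
      · apply Subrepresentation.toSubmodule_injective
        change N.toSubmodule = ⊥
        rw [← LinearMap.le_ker_iff_map, Submodule.ker_subtype, le_bot_iff] at h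
        rw [eq_bot_iff]
        intro x hx
        have hx' : c.symm x ∈ N.toSubmodule.comap c.toLinearMap := by
          simpa using hx
        rw [h, Submodule.mem_bot] at hx'
        simpa using hx'
      · apply Subrepresentation.toSubmodule_injective
        change N.toSubmodule = ⊤
        rw [eq_top_iff]
        intro x _
        have hx : ((c.symm x : M) : E) ∈ (N.toSubmodule.comap c.toLinearMap).map M.subtype := by
          rw [h]; exact (c.symm x).2
        obtain ⟨v, hv, hvx⟩ := hx
        have : v = c.symm x := Subtype.ext hvx
        subst this
        simpa using hv
  have hle : ‖Matrix.toEuclideanCLM (n := Fin _) (𝕜 := ℂ) (fourierCoeff A ρ)‖ ≤ nu A :=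
    le_csSup (fourierNorms_bddAbove A) ⟨_, ρ, hirr, hne, rfl⟩
  have hcoord : Matrix.toEuclideanCLM (n := Fin _) (𝕜 := ℂ) (fourierCoeff A ρ) (e ⟨w, hw⟩) =
      e (∑ a ∈ A, R a ⟨w, hw⟩) := by
    rw [fourierCoeff, map_sum, map_sum, sum_apply]
    refine Finset.sum_congr rfl fun a _ => ?_
    exact (WithLp.ofLp_injective 2) (hρV a ⟨w, hw⟩)
  have hnorm : ‖∑ a ∈ A, U a w‖ = ‖∑ a ∈ A, R a ⟨w, hw⟩‖ := by
    change _ = ‖((∑ a ∈ A, R a ⟨w, hw⟩ : M) : E)‖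
    rw [Submodule.coe_sum]
    rfl
  rw [hnorm, ← e.norm_map, ← hcoord]
  refine (ContinuousLinearMap.le_opNorm _ _).trans ?_
  rw [e.norm_map]
  exact mul_le_mul_of_nonneg_right hle (norm_nonneg _)

/-- A unitary representation without fixed vectors is an orthogonal sum of nontrivial irreducible
ones, so `∑ a ∈ A, U a` has norm at most `nu A`. The induction on the dimension splits off one
minimal invariant subspace at a time. -/
theorem norm_sum_le_nu_mul [FiniteDimensional ℂ E] (U : G →* (E ≃ₗᵢ[ℂ] E)) (A : Finset G)
    (W : Submodule ℂ E) (hW : ∀ g, ∀ w ∈ W, U g w ∈ W)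
    (hfix : ∀ w ∈ W, (∀ g, U g w = w) → w = 0) (w : E) (hw : w ∈ W) :
    ‖∑ a ∈ A, U a w‖ ≤ nu A * ‖w‖ := by
  induction hn : Module.finrank ℂ W using Nat.strong_induction_on generalizing W w with
  | _ n ih =>
  subst hn
  by_cases hbot : W = ⊥
  · subst hbot
    rw [Submodule.mem_bot] at hw
    simp [hw]
  have hwf : WellFounded ((· < ·) : Submodule ℂ E → Submodule ℂ E → Prop) := wellFounded_lt
  obtain ⟨M, ⟨hMW, hM, hM0⟩, hMmin⟩ := hwf.has_min
    {M : Submodule ℂ E | M ≤ W ∧ (∀ g, ∀ w ∈ M, U g w ∈ M) ∧ M ≠ ⊥} ⟨W, le_rfl, hW, hbot⟩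
  have hmin : ∀ N ≤ M, (∀ g, ∀ w ∈ N, U g w ∈ N) → N = ⊥ ∨ N = M := by
    intro N hN hNinv
    by_contra! hcon
    exact hMmin N ⟨hN.trans hMW, hNinv, hcon.1⟩ (lt_of_le_of_ne hN hcon.2)
  have hperp : ∀ g, ∀ w ∈ Mᗮ, U g w ∈ Mᗮ := by
    intro g w hw u hu
    have h1 : U g (U g⁻¹ u) = u := by
      change (U g * U g⁻¹) u = u
      rw [← map_mul, mul_inv_cancel, map_one]; rfl
    rw [← h1, LinearIsometryEquiv.inner_map_map]
    exact hw _ (hM _ _ hu)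
  obtain ⟨u, hu, v, hv, rfl⟩ := M.exists_add_mem_mem_orthogonal w
  have hvW : v ∈ W := by
    have := W.sub_mem hw (hMW hu)
    rwa [add_sub_cancel_left] at this
  have hlt : Module.finrank ℂ (W ⊓ Mᗮ : Submodule ℂ E) < Module.finrank ℂ W := by
    refine Submodule.finrank_lt_finrank_of_lt (lt_of_le_of_ne inf_le_left fun h => hM0 ?_)
    have h1 : M ≤ Mᗮ := (hMW.trans h.ge).trans inf_le_right
    rw [← Submodule.inf_orthogonal_eq_bot M, inf_eq_left.2 h1]
  have bu := norm_sum_le_of_minimal U A M hM hM0 hmin (fun w hw => hfix w (hMW hw)) u hu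
  have bv := ih _ hlt (W ⊓ Mᗮ) (fun g w hw => ⟨hW g w hw.1, hperp g w hw.2⟩)
    (fun w hw => hfix w hw.1) v ⟨hvW, hv⟩ rfl
  have hsum : ∑ a ∈ A, U a (u + v) = ∑ a ∈ A, U a u + ∑ a ∈ A, U a v := by
    simp [Finset.sum_add_distrib]
  have ho : inner ℂ (∑ a ∈ A, U a u) (∑ a ∈ A, U a v) = 0 :=
    (Submodule.sum_mem _ fun a _ => hperp a v hv) _ (Submodule.sum_mem _ fun a _ => hM a u hu)
  have p1 := norm_add_sq_eq_norm_sq_add_norm_sq_of_inner_eq_zero _ _ ho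
  have p2 := norm_add_sq_eq_norm_sq_add_norm_sq_of_inner_eq_zero _ _ (hv u hu)
  rw [hsum]
  refine (sq_le_sq₀ (norm_nonneg _) (mul_nonneg (nu_nonneg A) (norm_nonneg _))).1 ?_
  have q1 := mul_self_le_mul_self (norm_nonneg _) bu
  have q2 := mul_self_le_mul_self (norm_nonneg _) bv
  calc ‖∑ a ∈ A, U a u + ∑ a ∈ A, U a v‖ ^ 2
      ≤ nu A ^ 2 * (‖u‖ * ‖u‖ + ‖v‖ * ‖v‖) := by rw [sq, p1]; linarith
    _ = (nu A * ‖u + v‖) ^ 2 := by rw [← p2]; ring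

end Fourier

/-! ### Bilinear forms of a subset of a finite group -/

section Bilinear

variable {G : Type*} [Group G] [Fintype G]

/-- Translation of functions on a finite group, `(U g f) x = f (g⁻¹ x)`, as a unitary
representation. -/
noncomputable def leftRegular (G : Type*) [Group G] [Fintype G] :
    G →* (EuclideanSpace ℂ G ≃ₗᵢ[ℂ] EuclideanSpace ℂ G) where
  toFun g := LinearIsometryEquiv.piLpCongrLeft 2 ℂ ℂ (Equiv.mulLeft g)
  map_one' := by
    ext f x
    simp only [LinearIsometryEquiv.piLpCongrLeft_apply]
    change f (1⁻¹ * x) = f x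
    simp
  map_mul' g h := by
    ext f x
    simp only [LinearIsometryEquiv.piLpCongrLeft_apply]
    change f ((g * h)⁻¹ * x) = f (h⁻¹ * (g⁻¹ * x))
    rw [mul_inv_rev, mul_assoc]

theorem leftRegular_apply (g : G) (f : EuclideanSpace ℂ G) (x : G) :
    leftRegular G g f x = f (g⁻¹ * x) := by
  simp [leftRegular, LinearIsometryEquiv.piLpCongrLeft_apply]

theorem norm_sum_leftRegular_le (A : Finset G) (f : EuclideanSpace ℂ G) (hf : ∑ x, f x = 0) :
    ‖∑ a ∈ A, leftRegular G a f‖ ≤ nu A * ‖f‖ := by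
  let W : Submodule ℂ (EuclideanSpace ℂ G) :=
    { carrier := {f | ∑ x, f x = 0}
      add_mem' := fun {a b} ha hb => by
        simp only [Set.mem_ofPred_eq, PiLp.add_apply, Finset.sum_add_distrib] at *
        rw [ha, hb, add_zero]
      zero_mem' := by simp
      smul_mem' := fun c a ha => by
        simp only [Set.mem_ofPred_eq, PiLp.smul_apply, ← Finset.smul_sum] at *
        rw [ha, smul_zero] }
  refine norm_sum_le_nu_mul (leftRegular G) A W (fun g w hw => ?_) (fun w hw hfix => ?_) f hf
  · change ∑ x, leftRegular G g w x = 0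
    simp_rw [leftRegular_apply]
    exact (Equiv.sum_comp (Equiv.mulLeft g⁻¹) (fun x => w x)).trans hw
  · have hconst : ∀ x, w x = w 1 := by
      intro x
      have h := congrArg (fun f : EuclideanSpace ℂ G => f x) (hfix x)
      simp only [leftRegular_apply, inv_mul_cancel] at h
      exact h.symm
    have h0 : ∑ x, w x = 0 := hw
    simp_rw [hconst] at h0
    have h1 : w 1 = 0 := by simpa using h0
    ext x
    rw [hconst, h1]; rfl

variable [DecidableEq G]

/-- The bilinear form of the matrix `(x, y) ↦ 1_A (x * y)` is `⟪f, ∑ a ∈ A, U a h'⟫` for the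
regular representation `U` and `h' x = h x⁻¹`; the sum of `h` vanishing means that `h'` lies in the
part without fixed vectors. -/
theorem abs_sum_mul_mem_le (A : Finset G) (f h : G → ℝ) (hh : ∑ x, h x = 0) :
    |∑ x, ∑ y, if x * y ∈ A then f x * h y else 0| ≤
      nu A * (√(∑ x, f x ^ 2) * √(∑ x, h x ^ 2)) := by
  let F : EuclideanSpace ℂ G := WithLp.toLp 2 fun x => (f x : ℂ)
  let H : EuclideanSpace ℂ G := WithLp.toLp 2 fun x => (h x⁻¹ : ℂ)
  have hF : ‖F‖ = √(∑ x, f x ^ 2) := by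
    rw [EuclideanSpace.norm_eq]; simp [F]
  have hH : ‖H‖ = √(∑ x, h x ^ 2) := by
    rw [EuclideanSpace.norm_eq, ← Equiv.sum_comp (Equiv.inv G) (fun x => h x ^ 2)]; simp [H]
  have hH0 : ∑ x, H x = 0 := by
    have h1 := Equiv.sum_comp (Equiv.inv G) h
    rw [hh] at h1
    simp only [H]
    rw [← Complex.ofReal_sum]
    exact_mod_cast h1
  have key : ((∑ x, ∑ y, if x * y ∈ A then f x * h y else 0 : ℝ) : ℂ) =
      inner ℂ F (∑ a ∈ A, leftRegular G a H) := by
    rw [inner_sum]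
    simp only [PiLp.inner_apply, leftRegular_apply, F, H, RCLike.inner_apply, mul_inv_rev, inv_inv,
      Complex.conj_ofReal]
    push_cast
    rw [Finset.sum_comm (s := A)]
    refine Finset.sum_congr rfl fun x _ => ?_
    rw [← Equiv.sum_comp (Equiv.mulLeft x⁻¹)]
    simp only [Equiv.coe_mulLeft, mul_inv_cancel_left]
    simp [Finset.sum_ite_mem, apply_ite Complex.ofReal, mul_comm]
  have h1 : |∑ x, ∑ y, if x * y ∈ A then f x * h y else 0| =
      ‖inner ℂ F (∑ a ∈ A, leftRegular G a H)‖ := by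
    rw [← key, Complex.norm_real, Real.norm_eq_abs]
  rw [h1]
  refine (norm_inner_le_norm _ _).trans ?_
  calc ‖F‖ * ‖∑ a ∈ A, leftRegular G a H‖ ≤ ‖F‖ * (nu A * ‖H‖) :=
        mul_le_mul_of_nonneg_left (norm_sum_leftRegular_le A H hH0) (norm_nonneg _)
    _ = _ := by rw [hF, hH]; ring

theorem card_filter_mul_left_mem (A : Finset G) (x : G) :
    (Finset.univ.filter fun y => x * y ∈ A).card = A.card :=
  Finset.card_bij (fun y _ => x * y) (by simp) (by simp)
    fun a ha => ⟨x⁻¹ * a, by simpa using ha, by simp⟩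

/-- The mean parts of `f` and `h` contribute `|A| / |G| * (∑ f) * (∑ h)` to the bilinear form, which
the square absorbs because `|A| ≤ |G|`; the remainder is controlled by `nu A`. -/
theorem neg_nu_mul_le_of_mul (A : Finset G) (f h : G → ℝ) (ε : ℝ) (hε : ε ^ 2 = 1) :
    -(nu A * (∑ x, f x ^ 2 + ∑ x, h x ^ 2)) ≤
      -2 * ε * (∑ x, ∑ y, if x * y ∈ A then f x * h y else 0) +
        (∑ x, f x + ε * ∑ x, h x) ^ 2 := by
  obtain ⟨N, hN⟩ : ∃ N : ℝ, N = Fintype.card G := ⟨_, rfl⟩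
  have hNpos : 0 < N := by rw [hN]; exact_mod_cast Fintype.card_pos
  set S := ∑ x, f x
  set T := ∑ x, h x with hT
  set c := T / N with hc
  have hcN : N * c = T := by rw [hc]; field_simp
  have h0sum : ∑ x, (h x - c) = 0 := by
    rw [Finset.sum_sub_distrib, Finset.sum_const, Finset.card_univ, nsmul_eq_mul, ← hN, hcN, ← hT,
      sub_self]
  have h0sq : ∑ x, (h x - c) ^ 2 ≤ ∑ x, h x ^ 2 := by
    have : ∑ x, (h x - c) ^ 2 = ∑ x, h x ^ 2 - 2 * c * T + N * c ^ 2 := by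
      simp only [sub_sq, Finset.sum_add_distrib, Finset.sum_sub_distrib, Finset.sum_const,
        Finset.card_univ, nsmul_eq_mul]
      rw [← Finset.sum_mul, ← Finset.mul_sum, ← hT, ← hN]
      ring
    rw [this, ← hcN]
    nlinarith [mul_nonneg hNpos.le (sq_nonneg c)]
  have hsplit : (∑ x, ∑ y, if x * y ∈ A then f x * h y else 0) =
      (∑ x, ∑ y, if x * y ∈ A then f x * (h y - c) else 0) + A.card * c * S := by
    rw [Finset.mul_sum, ← Finset.sum_add_distrib]
    refine Finset.sum_congr rfl fun x _ => ?_
    rw [← Finset.sum_filter, ← Finset.sum_filter, ← card_filter_mul_left_mem A x]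
    simp only [mul_sub, Finset.sum_sub_distrib, Finset.sum_const, nsmul_eq_mul]
    ring
  have hb := abs_sum_mul_mem_le A f (fun y => h y - c) h0sum
  set B := ∑ x, ∑ y, if x * y ∈ A then f x * (h y - c) else 0
  have hsq : √(∑ x, f x ^ 2) * √(∑ x, (h x - c) ^ 2) ≤ (∑ x, f x ^ 2 + ∑ x, h x ^ 2) / 2 := by
    have e1 := Real.sq_sqrt (Finset.sum_nonneg fun x (_ : x ∈ Finset.univ) => sq_nonneg (f x))
    have e2 := Real.sq_sqrt
      (Finset.sum_nonneg fun x (_ : x ∈ Finset.univ) => sq_nonneg (h x - c))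
    nlinarith [sq_nonneg (√(∑ x, f x ^ 2) - √(∑ x, (h x - c) ^ 2))]
  have hB : |B| ≤ nu A * ((∑ x, f x ^ 2 + ∑ x, h x ^ 2) / 2) :=
    hb.trans (mul_le_mul_of_nonneg_left hsq (nu_nonneg A))
  have hεB : ε * B ≤ |B| := by
    have : |ε| = 1 := by rw [← sq_eq_sq₀ (abs_nonneg _) zero_le_one, sq_abs, hε, one_pow]
    calc ε * B ≤ |ε * B| := le_abs_self _
      _ = |B| := by rw [abs_mul, this, one_mul]
  -- `r` is the density of `A`
  obtain ⟨r, hr⟩ : ∃ r : ℝ, r = A.card / N := ⟨_, rfl⟩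
  have hr0 : 0 ≤ r := by rw [hr]; positivity
  have hr1 : r ≤ 1 := by
    rw [hr, div_le_one hNpos, hN]; exact_mod_cast Finset.card_le_univ A
  have hAc : (A.card : ℝ) * c = r * T := by rw [hc, hr]; ring
  have hmean : 0 ≤ -2 * ε * (r * T * S) + (S + ε * T) ^ 2 := by
    have : -2 * ε * (r * T * S) + (S + ε * T) ^ 2 =
        r * (S ^ 2 + ε ^ 2 * T ^ 2) + (1 - r) * (S + ε * T) ^ 2 := by ring
    rw [this]
    have : 0 ≤ 1 - r := sub_nonneg.2 hr1
    positivity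
  rw [hsplit, hAc]
  linarith

/-- The same bound when the product is interspersed with fixed group elements. -/
theorem neg_nu_mul_le (A : Finset G) (P Q R : G) (f h : G → ℝ) (ε : ℝ) (hε : ε ^ 2 = 1) :
    -(nu A * (∑ x, f x ^ 2 + ∑ x, h x ^ 2)) ≤
      -2 * ε * (∑ a, ∑ b, if P * a * Q * b * R ∈ A then f a * h b else 0) +
        (∑ x, f x + ε * ∑ x, h x) ^ 2 := by
  let α : G ≃ G := (Equiv.mulLeft P)
  let β : G ≃ G := (Equiv.mulLeft Q).trans (Equiv.mulRight R)
  have key := neg_nu_mul_le_of_mul A (f ∘ α.symm) (h ∘ β.symm) ε hε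
  have e1 := Equiv.sum_comp α.symm (fun x => f x ^ 2)
  have e2 := Equiv.sum_comp β.symm (fun x => h x ^ 2)
  have e3 := Equiv.sum_comp α.symm f
  have e4 := Equiv.sum_comp β.symm h
  have e5 : (∑ x, ∑ y, if x * y ∈ A then f (α.symm x) * h (β.symm y) else 0) =
      ∑ a, ∑ b, if P * a * Q * b * R ∈ A then f a * h b else 0 := by
    rw [← Equiv.sum_comp α]
    refine Finset.sum_congr rfl fun a _ => ?_
    rw [← Equiv.sum_comp β]
    refine Finset.sum_congr rfl fun b _ => ?_
    simp [α, β, mul_assoc]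
  simp only [Function.comp_apply, e1, e2, e3, e4, e5] at key
  exact key

end Bilinear

/-! ### Cochains as functions on ordered simplices -/

section Ordered

variable {V : Type*} {X : PreAbstractSimplicialComplex V} {m : ℕ}

theorem OrderedSimplex.reorder_reorder (σ : OrderedSimplex X m) (π π' : Equiv.Perm (Fin m)) :
    (σ.reorder π).reorder π' = σ.reorder (π * π') := rfl

theorem OrderedSimplex.reorder_one (σ : OrderedSimplex X m) : σ.reorder 1 = σ := rfl

theorem OrderedSimplex.reorder_right_injective (σ : OrderedSimplex X m) :
    Function.Injective σ.reorder := by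
  intro π π' h
  ext1 i
  have h' := congrArg (fun τ : OrderedSimplex X m => τ.1 i) h
  exact σ.1.injective h'

/-- Reordering by `π` as a permutation of the ordered simplices. -/
def reorderEquiv (π : Equiv.Perm (Fin m)) : OrderedSimplex X m ≃ OrderedSimplex X m where
  toFun σ := σ.reorder π
  invFun σ := σ.reorder π⁻¹
  left_inv σ := by
    change (σ.reorder π).reorder π⁻¹ = σ
    rw [OrderedSimplex.reorder_reorder, mul_inv_cancel, OrderedSimplex.reorder_one]
  right_inv σ := by
    change (σ.reorder π⁻¹).reorder π = σ
    rw [OrderedSimplex.reorder_reorder, inv_mul_cancel, OrderedSimplex.reorder_one]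

theorem Cochain.apply_reorder (φ : Cochain X m) (σ : OrderedSimplex X m)
    (π : Equiv.Perm (Fin m)) : φ (σ.reorder π) = (Equiv.Perm.sign π : ℤ) * φ σ :=
  φ.2 σ π

theorem sign_mul_self (π : Equiv.Perm (Fin m)) :
    (((Equiv.Perm.sign π : ℤˣ) : ℤ) : ℝ) * ((Equiv.Perm.sign π : ℤˣ) : ℤ) = 1 := by
  rw [← Int.cast_mul, ← Units.val_mul, Int.units_mul_self]; simp

theorem Cochain.apply_reorder_mul (φ ψ : Cochain X m) (σ : OrderedSimplex X m)
    (π : Equiv.Perm (Fin m)) : φ (σ.reorder π) * ψ (σ.reorder π) = φ σ * ψ σ := by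
  rw [φ.apply_reorder, ψ.apply_reorder]
  linear_combination (φ σ * ψ σ) * sign_mul_self π

theorem map_univ_reorder (σ : OrderedSimplex X m) (π : Equiv.Perm (Fin m)) :
    Finset.univ.map (σ.reorder π).1 = Finset.univ.map σ.1 := by
  change Finset.univ.map (π.toEmbedding.trans σ.1) = _
  rw [← Finset.map_map, Finset.map_univ_equiv]

theorem map_univ_orient (s : Simplex X m) : Finset.univ.map s.orient.1 = s.1 := by
  change Finset.univ.map ((s.1.equivFinOfCardEq s.2.1).symm.toEmbedding.trans
    (Function.Embedding.subtype (· ∈ s.1))) = s.1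
  rw [← Finset.map_map, Finset.map_univ_equiv]
  ext x
  simp

theorem orient_reorder_bijective :
    Function.Bijective fun p : Simplex X m × Equiv.Perm (Fin m) => p.1.orient.reorder p.2 := by
  refine ⟨?_, fun σ => ?_⟩
  · rintro ⟨s, π⟩ ⟨t, π'⟩ h
    have h1 := congrArg (fun σ : OrderedSimplex X m => Finset.univ.map σ.1) h
    simp only [map_univ_reorder, map_univ_orient] at h1
    obtain rfl : s = t := Subtype.ext h1
    exact Prod.ext rfl (s.orient.reorder_right_injective h)
  · obtain ⟨s, π, h⟩ := exists_reorder_orient σ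
    exact ⟨(s, π), h.symm⟩

/-- Antisymmetrizing the indicator function of an ordered simplex gives a nonzero cochain. -/
theorem nontrivial_cochain (σ₀ : OrderedSimplex X m) : Nontrivial (Cochain X m) := by
  classical
  let δ : Cochain X m := ⟨fun σ => ∑ π : Equiv.Perm (Fin m),
    if σ = σ₀.reorder π then ((Equiv.Perm.sign π : ℤ) : ℝ) else 0, by
      intro σ τ
      change (∑ π : Equiv.Perm (Fin m), if σ.reorder τ = σ₀.reorder π then
        ((Equiv.Perm.sign π : ℤ) : ℝ) else 0) = (Equiv.Perm.sign τ : ℤ) *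
        ∑ π : Equiv.Perm (Fin m), if σ = σ₀.reorder π then ((Equiv.Perm.sign π : ℤ) : ℝ) else 0
      rw [← Equiv.sum_comp (Equiv.mulRight τ), Finset.mul_sum]
      refine Finset.sum_congr rfl fun π _ => ?_
      have hiff : σ.reorder τ = σ₀.reorder (π * τ) ↔ σ = σ₀.reorder π := by
        rw [← OrderedSimplex.reorder_reorder]
        exact (reorderEquiv τ).apply_eq_iff_eq
      simp only [Equiv.coe_mulRight, hiff, Equiv.Perm.sign_mul, mul_ite, mul_zero]
      split_ifs
      · push_cast; ring
      · rfl⟩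
  refine ⟨δ, 0, fun h => ?_⟩
  have h1 : δ σ₀ = 0 := by rw [h]; rfl
  have h2 : δ σ₀ = 1 := by
    change (∑ π : Equiv.Perm (Fin m), if σ₀ = σ₀.reorder π then
      ((Equiv.Perm.sign π : ℤ) : ℝ) else 0) = 1
    rw [Finset.sum_eq_single 1]
    · rw [if_pos σ₀.reorder_one.symm]; simp
    · intro π _ hπ
      rw [if_neg]
      intro h
      exact hπ (σ₀.reorder_right_injective (h.symm.trans σ₀.reorder_one.symm))
    · simp
  rw [h1] at h2
  exact zero_ne_one h2

variable [Fintype V]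

noncomputable instance : Fintype (OrderedSimplex X m) := Fintype.ofFinite _

theorem inner_eq_sum_orient (φ ψ : Cochain X m) :
    inner ℝ φ ψ = ∑ s : Simplex X m, φ s.orient * ψ s.orient := rfl

/-- Every simplex with `m` vertices has `m!` orderings. -/
theorem factorial_mul_inner (φ ψ : Cochain X m) :
    (m.factorial : ℝ) * inner ℝ φ ψ = ∑ σ : OrderedSimplex X m, φ σ * ψ σ := by
  rw [← Function.Bijective.sum_comp (orient_reorder_bijective (X := X) (m := m))
    (fun σ => φ σ * ψ σ), Fintype.sum_prod_type]
  simp only [Cochain.apply_reorder_mul]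
  rw [Finset.sum_comm, Finset.sum_const, inner_eq_sum_orient, Finset.card_univ, Fintype.card_perm,
    Fintype.card_fin, nsmul_eq_mul]

/-- The inner product can be computed with any system of representatives of the simplices. -/
theorem inner_eq_sum_of_bijective {ι : Type*} [Fintype ι] (e : ι → OrderedSimplex X m)
    (he : Function.Bijective fun p : ι × Equiv.Perm (Fin m) => (e p.1).reorder p.2)
    (φ ψ : Cochain X m) : inner ℝ φ ψ = ∑ x, φ (e x) * ψ (e x) := by
  have h := factorial_mul_inner φ ψ
  rw [← Function.Bijective.sum_comp he (fun σ => φ σ * ψ σ), Fintype.sum_prod_type] at h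
  simp only [Cochain.apply_reorder_mul] at h
  rw [Finset.sum_comm, Finset.sum_const, Finset.card_univ, Fintype.card_perm,
    Fintype.card_fin, nsmul_eq_mul] at h
  exact mul_left_cancel₀ (Nat.cast_ne_zero.2 m.factorial_ne_zero) h

theorem sum_sq_le_inner_of_injective {ι : Type*} [Fintype ι] (e : ι → OrderedSimplex X m)
    (he : Function.Injective fun p : ι × Equiv.Perm (Fin m) => (e p.1).reorder p.2)
    (φ : Cochain X m) : ∑ x, φ (e x) ^ 2 ≤ inner ℝ φ φ := by
  classical
  have h : ∑ p : ι × Equiv.Perm (Fin m),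
      φ ((e p.1).reorder p.2) * φ ((e p.1).reorder p.2) ≤
      ∑ σ : OrderedSimplex X m, φ σ * φ σ := by
    rw [← Finset.sum_image (f := fun σ => φ σ * φ σ)
      (g := fun p : ι × Equiv.Perm (Fin m) => (e p.1).reorder p.2) he.injOn]
    exact Finset.sum_le_sum_of_subset_of_nonneg (Finset.subset_univ _)
      fun σ _ _ => mul_self_nonneg _
  rw [← factorial_mul_inner, Fintype.sum_prod_type] at h
  simp only [Cochain.apply_reorder_mul] at h
  rw [Finset.sum_comm, Finset.sum_const, Finset.card_univ, Fintype.card_perm,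
    Fintype.card_fin, nsmul_eq_mul] at h
  simp only [sq]
  exact le_of_mul_le_mul_left h (Nat.cast_pos.2 m.factorial_pos)

end Ordered

/-! ### The adjoint of the coboundary operator -/

section Adjoint

variable {V : Type*} {X : PreAbstractSimplicialComplex V} {m : ℕ}

theorem coboundary_apply (ψ : Cochain X m) (σ : OrderedSimplex X (m + 1)) :
    coboundary X m ψ σ = ∑ i : Fin (m + 1), (-1 : ℝ) ^ (i : ℕ) * ψ (σ.face i) := rfl

theorem face_zero_reorder_decomposeFin (σ : OrderedSimplex X (m + 1)) (π : Equiv.Perm (Fin m)) :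
    (σ.reorder (Equiv.Perm.decomposeFin.symm (0, π))).face 0 = (σ.face 0).reorder π := by
  apply Subtype.ext
  ext1 j
  change σ.1 (Equiv.Perm.decomposeFin.symm (0, π) ((0 : Fin (m + 1)).succAbove j)) =
    σ.1 ((0 : Fin (m + 1)).succAbove (π j))
  simp

theorem face_reorder_cycleRange (σ : OrderedSimplex X (m + 1)) (i : Fin (m + 1)) :
    (σ.reorder i.cycleRange).face i = σ.face 0 := by
  apply Subtype.ext
  ext1 j
  change σ.1 (i.cycleRange (i.succAbove j)) = σ.1 ((0 : Fin (m + 1)).succAbove j)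
  rw [Fin.cycleRange_succAbove, Fin.succAbove_zero]

theorem Cochain.apply_reorder_cycleRange (φ : Cochain X (m + 1)) (σ : OrderedSimplex X (m + 1))
    (i : Fin (m + 1)) : φ (σ.reorder i.cycleRange) = (-1) ^ (i : ℕ) * φ σ := by
  rw [φ.apply_reorder, Fin.sign_cycleRange]
  simp

variable [Fintype V]

open Classical in
/-- The boundary of a cochain: its value on `τ` is the sum of `φ` over all ordered simplices
obtained by putting a new vertex in front of `τ`. -/
noncomputable def boundary (φ : Cochain X (m + 1)) : Cochain X m :=
  ⟨fun τ => ∑ σ : OrderedSimplex X (m + 1), if σ.face 0 = τ then φ σ else 0, by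
    intro τ π
    change (∑ σ : OrderedSimplex X (m + 1), if σ.face 0 = τ.reorder π then φ σ else 0) =
      (Equiv.Perm.sign π : ℤ) * ∑ σ : OrderedSimplex X (m + 1), if σ.face 0 = τ then φ σ else 0
    rw [← Equiv.sum_comp (reorderEquiv (Equiv.Perm.decomposeFin.symm (0, π))), Finset.mul_sum]
    refine Finset.sum_congr rfl fun σ _ => ?_
    have h1 : ((reorderEquiv (Equiv.Perm.decomposeFin.symm (0, π)) σ).face 0 = τ.reorder π) ↔
        σ.face 0 = τ := by
      change (σ.reorder _).face 0 = _ ↔ _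
      rw [face_zero_reorder_decomposeFin]
      exact (reorderEquiv π).apply_eq_iff_eq
    have h2 : φ (reorderEquiv (Equiv.Perm.decomposeFin.symm (0, π)) σ) =
        (Equiv.Perm.sign π : ℤ) * φ σ := by
      change φ (σ.reorder _) = _
      rw [φ.apply_reorder, Equiv.Perm.decomposeFin.symm_sign]
      simp
    simp only [h1, h2, mul_ite, mul_zero]⟩

open Classical in
theorem boundary_apply (φ : Cochain X (m + 1)) (τ : OrderedSimplex X m) :
    boundary φ τ = ∑ σ : OrderedSimplex X (m + 1), if σ.face 0 = τ then φ σ else 0 := rfl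

theorem inner_coboundary_eq_inner_boundary (ψ : Cochain X m) (φ : Cochain X (m + 1)) :
    inner ℝ (coboundary X m ψ) φ = inner ℝ ψ (boundary φ) := by
  classical
  have h1 := factorial_mul_inner (coboundary X m ψ) φ
  have h2 := factorial_mul_inner ψ (boundary φ)
  -- after rotating the `i`-th vertex to the front, the `m + 1` faces contribute equally
  have h3 : ∑ σ : OrderedSimplex X (m + 1), coboundary X m ψ σ * φ σ =
      (m + 1) * ∑ σ : OrderedSimplex X (m + 1), ψ (σ.face 0) * φ σ := by
    simp only [coboundary_apply, Finset.sum_mul]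
    rw [Finset.sum_comm]
    have : ∀ i : Fin (m + 1), ∑ σ : OrderedSimplex X (m + 1),
        (-1 : ℝ) ^ (i : ℕ) * ψ (σ.face i) * φ σ =
        ∑ σ : OrderedSimplex X (m + 1), ψ (σ.face 0) * φ σ := by
      intro i
      rw [← Equiv.sum_comp (reorderEquiv i.cycleRange)]
      refine Finset.sum_congr rfl fun σ _ => ?_
      change (-1 : ℝ) ^ (i : ℕ) * ψ ((σ.reorder i.cycleRange).face i) *
        φ (σ.reorder i.cycleRange) = _
      rw [face_reorder_cycleRange, φ.apply_reorder_cycleRange]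
      have : ((-1 : ℝ) ^ (i : ℕ)) * (-1 : ℝ) ^ (i : ℕ) = 1 := by rw [← mul_pow]; simp
      linear_combination (ψ (σ.face 0) * φ σ) * this
    simp only [this, Finset.sum_const, Finset.card_univ, Fintype.card_fin, nsmul_eq_mul]
    push_cast
    ring
  have h4 : ∑ τ : OrderedSimplex X m, ψ τ * boundary φ τ =
      ∑ σ : OrderedSimplex X (m + 1), ψ (σ.face 0) * φ σ := by
    simp only [boundary_apply, Finset.mul_sum]
    rw [Finset.sum_comm]
    refine Finset.sum_congr rfl fun σ _ => ?_
    simp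
  have hm : ((m.factorial : ℕ) : ℝ) ≠ 0 := Nat.cast_ne_zero.2 m.factorial_ne_zero
  have hm1 : ((m : ℝ) + 1) ≠ 0 := by positivity
  rw [h3, ← h4, ← h2, Nat.factorial_succ] at h1
  push_cast at h1
  rw [← mul_assoc] at h1
  exact mul_left_cancel₀ (mul_ne_zero hm1 hm) h1

theorem adjoint_coboundary_apply (φ : Cochain X (m + 1)) :
    LinearMap.adjoint (coboundary X m) φ = boundary φ := by
  refine ext_inner_left ℝ fun ψ => ?_
  rw [LinearMap.adjoint_inner_right, inner_coboundary_eq_inner_boundary]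

theorem le_spectralGap_of_forall (j : ℕ) [Nontrivial (Cochain X (j + 1))] (c : ℝ)
    (h : ∀ φ : Cochain X (j + 1), c * inner ℝ φ φ ≤ inner ℝ (boundary φ) (boundary φ) +
      inner ℝ (coboundary X (j + 1) φ) (coboundary X (j + 1) φ)) :
    c ≤ spectralGap X j := by
  obtain ⟨φ, hφ⟩ := (spectralGap_isLeast X j).1.exists_hasEigenvector
  have h1 := h φ
  have h2 : inner ℝ (laplacian X j φ) φ = inner ℝ (boundary φ) (boundary φ) +
      inner ℝ (coboundary X (j + 1) φ) (coboundary X (j + 1) φ) := by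
    rw [laplacian, LinearMap.add_apply, inner_add_left, LinearMap.comp_apply,
      LinearMap.comp_apply, LinearMap.adjoint_inner_left, adjoint_coboundary_apply,
      inner_coboundary_eq_inner_boundary]
  rw [hφ.apply_eq_smul, real_inner_smul_left] at h2
  rw [← h2] at h1
  exact le_of_mul_le_mul_right h1 (real_inner_self_pos.2 hφ.2)

end Adjoint

/-! ### Sums over tuples of group elements -/

section Tuples

/-- Pairs `i ≤ j` in `Fin m`. They stand for the pairs `i.castSucc < j.succ` in `Fin (m + 1)`. -/
abbrev LePair (m : ℕ) : Type := {x : Fin m × Fin m // x.1 ≤ x.2}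

theorem sum_sum_eq_diag_add_lePair {m : ℕ} (g : Fin (m + 1) → Fin (m + 1) → ℝ)
    (hg : ∀ p q, g p q = g q p) :
    ∑ p, ∑ q, g p q = ∑ p, g p p + 2 * ∑ x : LePair m, g x.1.1.castSucc x.1.2.succ := by
  have h1 : ∀ p q, g p q = (if p = q then g p q else 0) + (if p < q then g p q else 0) +
      (if q < p then g q p else 0) := by
    intro p q
    rcases lt_trichotomy p q with h | h | h
    · simp [h, h.ne, h.not_gt]
    · simp [h]
    · simp [h, h.ne', h.not_gt, hg p q]
  have h2 : ∑ p, ∑ q, (if p < q then g p q else 0) =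
      ∑ x : LePair m, g x.1.1.castSucc x.1.2.succ := by
    rw [Fin.sum_univ_castSucc]
    simp only [Fin.sum_univ_succ (n := m), Fin.castSucc_lt_succ_iff, Fin.not_lt_zero, if_false,
      zero_add, (Fin.le_last _).not_gt, Finset.sum_const_zero, add_zero]
    rw [← Fintype.sum_prod_type' (f := fun i j : Fin m => if i ≤ j then g i.castSucc j.succ else 0),
      ← Finset.sum_filter]
    exact Finset.sum_subtype _ (by simp) _
  calc ∑ p, ∑ q, g p q = ∑ p, ∑ q, (if p = q then g p q else 0) +
        ∑ p, ∑ q, (if p < q then g p q else 0) + ∑ p, ∑ q, (if q < p then g q p else 0) := by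
        simp only [← Finset.sum_add_distrib]
        exact Finset.sum_congr rfl fun p _ => Finset.sum_congr rfl fun q _ => h1 p q
    _ = _ := by
        rw [Finset.sum_comm (f := fun p q => if q < p then g q p else 0), h2]
        simp only [Finset.sum_ite_eq, Finset.mem_univ, if_true]
        ring

theorem sum_sq_eq_lePair {m : ℕ} (x : Fin (m + 1) → ℝ) :
    (∑ p, x p) ^ 2 = ∑ p, x p ^ 2 + 2 * ∑ t : LePair m, x t.1.1.castSucc * x t.1.2.succ := by
  rw [sq, Finset.sum_mul_sum, sum_sum_eq_diag_add_lePair _ fun p q => mul_comm _ _]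
  simp only [sq]

theorem sum_lePair_add {m : ℕ} (u : Fin (m + 1) → ℝ) :
    ∑ t : LePair m, (u t.1.1.castSucc + u t.1.2.succ) = m * ∑ p, u p := by
  have h := sum_sum_eq_diag_add_lePair (fun p q => u p + u q) fun p q => add_comm _ _
  simp only [Finset.sum_add_distrib, Finset.sum_const, Finset.card_univ, Fintype.card_fin,
    nsmul_eq_mul, ← Finset.mul_sum] at h ⊢
  push_cast at h
  linarith

variable {n : ℕ} {i j : Fin (n + 1)}

theorem castSucc_succAbove_of_le (h : i ≤ j) : i.castSucc.succAbove j = j.succ :=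
  Fin.succAbove_of_le_castSucc _ _ (Fin.castSucc_le_castSucc_iff.2 h)

theorem succ_succAbove_of_le (h : i ≤ j) : j.succ.succAbove i = i.castSucc :=
  Fin.succAbove_of_castSucc_lt _ _ (Fin.castSucc_lt_succ_iff.2 h)

theorem succAbove_succAbove_of_le (h : i ≤ j) (l : Fin n) :
    i.castSucc.succAbove (j.succAbove l) = j.succ.succAbove (i.succAbove l) := by
  simp only [Fin.succAbove, Fin.lt_def, Fin.le_def, Fin.ext_iff] at *
  split_ifs <;> simp_all <;> omega

theorem eq_or_eq_of_ne_succAbove (h : i ≤ j) (x : Fin (n + 2))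
    (hx : ∀ l : Fin n, i.castSucc.succAbove (j.succAbove l) ≠ x) :
    x = i.castSucc ∨ x = j.succ := by
  by_contra! hcon
  obtain ⟨t, rfl⟩ := Fin.exists_succAbove_eq hcon.1
  have ht : t ≠ j := by
    rintro rfl
    exact hcon.2 (castSucc_succAbove_of_le h)
  obtain ⟨l, rfl⟩ := Fin.exists_succAbove_eq ht
  exact hx l rfl

/-- A pair of deleted positions is determined by the remaining ones. -/
theorem lePair_eq_of_succAbove_eq {t t' : LePair (n + 1)}
    (h : ∀ l : Fin n, t.1.1.castSucc.succAbove (t.1.2.succAbove l) =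
      t'.1.1.castSucc.succAbove (t'.1.2.succAbove l)) : t = t' := by
  obtain ⟨⟨i, j⟩, hij⟩ := t
  obtain ⟨⟨i', j'⟩, hij'⟩ := t'
  simp only at h hij hij'
  have h1 := eq_or_eq_of_ne_succAbove hij' i.castSucc fun l hl =>
    Fin.succAbove_ne i.castSucc (j.succAbove l) ((h l).trans hl)
  have h2 := eq_or_eq_of_ne_succAbove hij' j.succ fun l hl => by
    rw [← h l, succAbove_succAbove_of_le hij] at hl
    exact Fin.succAbove_ne _ _ hl
  simp only [Subtype.mk.injEq, Prod.mk.injEq, Fin.ext_iff, Fin.val_castSucc, Fin.val_succ] at *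
  omega

variable {G : Type*}

theorem insertNth_comp_castSucc_succAbove (h : i ≤ j) (a b : G) (w : Fin n → G) :
    (fun l => Fin.insertNth (α := fun _ => G) j.succ b (Fin.insertNth (α := fun _ => G) i a w)
      (i.castSucc.succAbove l)) = Fin.insertNth (α := fun _ => G) j b w := by
  funext l
  refine Fin.succAboveCases j ?_ (fun l => ?_) l
  · rw [castSucc_succAbove_of_le h]; simp
  · rw [succAbove_succAbove_of_le h]; simp

theorem sum_insertNth [Fintype G] (p : Fin (n + 1)) (H : (Fin (n + 1) → G) → ℝ) :
    ∑ y, H y = ∑ z : Fin n → G, ∑ a, H (Fin.insertNth (α := fun _ => G) p a z) := by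
  rw [← Equiv.sum_comp (Fin.insertNthEquiv (fun _ => G) p), Fintype.sum_prod_type,
    Finset.sum_comm]
  rfl

variable [Group G]

theorem exists_prod_update {N : ℕ} (y : Fin N → G) (p : Fin N) :
    ∃ P R : G, ∀ a, (List.ofFn (Function.update y p a)).prod = P * a * R := by
  induction N with
  | zero => exact p.elim0
  | succ N ih =>
    refine Fin.cases ?_ (fun p => ?_) p
    · refine ⟨1, (List.ofFn fun l : Fin N => y l.succ).prod, fun a => ?_⟩
      simp [List.ofFn_succ]
    · obtain ⟨P, R, h⟩ := ih (fun l => y l.succ) p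
      refine ⟨y 0 * P, R, fun a => ?_⟩
      have h1 : (fun l : Fin N => Function.update y p.succ a l.succ) =
          Function.update (fun l => y l.succ) p a := by
        funext l
        simp [Function.update_apply]
      rw [List.ofFn_succ, List.prod_cons, h1, h]
      simp [mul_assoc, (Fin.succ_ne_zero _).symm]

theorem exists_prod_update_update {N : ℕ} (y : Fin N → G) (p q : Fin N) (hpq : p < q) :
    ∃ P Q R : G, ∀ a b, (List.ofFn (Function.update (Function.update y p a) q b)).prod =
      P * a * Q * b * R := by
  induction N with
  | zero => exact p.elim0
  | succ N ih =>
    obtain ⟨q, rfl⟩ := Fin.exists_succ_eq.2 (Fin.ne_zero_of_lt hpq)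
    revert hpq
    refine Fin.cases (fun _ => ?_) (fun p hpq => ?_) p
    · obtain ⟨P, R, h⟩ := exists_prod_update (fun l => y l.succ) q
      refine ⟨1, P, R, fun a b => ?_⟩
      have h1 : (fun l : Fin N => Function.update (Function.update y 0 a) q.succ b l.succ) =
          Function.update (fun l => y l.succ) q b := by
        funext l
        simp [Function.update_apply]
      rw [List.ofFn_succ, List.prod_cons, h1, h]
      simp [mul_assoc, (Fin.succ_ne_zero _).symm]
    · obtain ⟨P, Q, R, h⟩ := ih (fun l => y l.succ) p q (Fin.succ_lt_succ_iff.1 hpq)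
      refine ⟨y 0 * P, Q, R, fun a b => ?_⟩
      have h1 : (fun l : Fin N => Function.update (Function.update y p.succ a) q.succ b l.succ) =
          Function.update (Function.update (fun l => y l.succ) p a) q b := by
        funext l
        simp [Function.update_apply]
      rw [List.ofFn_succ, List.prod_cons, h1, h]
      simp [mul_assoc, (Fin.succ_ne_zero _).symm]

theorem exists_prod_insertNth (p : Fin (n + 1)) (z : Fin n → G) :
    ∃ P R : G, ∀ a, (List.ofFn (Fin.insertNth (α := fun _ => G) p a z)).prod = P * a * R := by
  obtain ⟨P, R, h⟩ := exists_prod_update (Fin.insertNth (α := fun _ => G) p 1 z) p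
  refine ⟨P, R, fun a => ?_⟩
  rw [← h, Fin.update_insertNth]

theorem exists_prod_insertNth_insertNth (h : i ≤ j) (w : Fin n → G) :
    ∃ P Q R : G, ∀ a b, (List.ofFn (Fin.insertNth (α := fun _ => G) j.succ b
      (Fin.insertNth (α := fun _ => G) i a w))).prod = P * a * Q * b * R := by
  obtain ⟨P, Q, R, hP⟩ := exists_prod_update_update
    (Fin.insertNth (α := fun _ => G) j.succ 1 (Fin.insertNth (α := fun _ => G) i 1 w))
    i.castSucc j.succ (Fin.castSucc_lt_succ_iff.2 h)
  refine ⟨P, Q, R, fun a b => ?_⟩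
  rw [← hP]
  congr 2
  have hne : i.castSucc ≠ j.succ := (Fin.castSucc_lt_succ_iff.2 h).ne
  funext l
  refine Fin.succAboveCases j.succ ?_ (fun l => ?_) l
  · simp
  · refine Fin.succAboveCases i ?_ (fun l => ?_) l
    · rw [succ_succAbove_of_le h, Function.update_of_ne hne, Function.update_self,
        ← succ_succAbove_of_le h, Fin.insertNth_apply_succAbove, Fin.insertNth_apply_same]
    · rw [Function.update_of_ne (Fin.succAbove_ne _ _), Function.update_of_ne]
      · simp
      · rw [← succAbove_succAbove_of_le h]
        exact Fin.succAbove_ne _ _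

variable [Fintype G] [DecidableEq G]

theorem card_filter_prod_insertNth_mem (A : Finset G) (p : Fin (n + 1)) (z : Fin n → G) :
    (Finset.univ.filter fun a =>
      (List.ofFn (Fin.insertNth (α := fun _ => G) p a z)).prod ∈ A).card = A.card := by
  obtain ⟨P, R, h⟩ := exists_prod_insertNth p z
  simp only [h]
  exact Finset.card_bij (fun a _ => P * a * R) (by simp) (by simp)
    fun a ha => ⟨P⁻¹ * a * R⁻¹, by simpa [mul_assoc] using ha, by simp [mul_assoc]⟩

/-- The squares in the expansion of the coboundary: every codimension-one simplex lies in exactly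
`|A|` top simplices. -/
theorem sum_sq_prod_mem (A : Finset G) (p : Fin (n + 1)) (F : (Fin n → G) → ℝ) :
    (∑ y : Fin (n + 1) → G, if (List.ofFn y).prod ∈ A then F (fun l => y (p.succAbove l)) ^ 2
      else 0) = A.card * ∑ z, F z ^ 2 := by
  rw [sum_insertNth p, Finset.mul_sum]
  refine Finset.sum_congr rfl fun z _ => ?_
  simp only [Fin.insertNth_apply_succAbove]
  rw [← Finset.sum_filter, Finset.sum_const, card_filter_prod_insertNth_mem, nsmul_eq_mul]

/-- For one pair of colors, the cross terms of the coboundary together with the squared boundary. -/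
theorem neg_nu_mul_le_pair (A : Finset G) (h : i ≤ j)
    (F : Fin (n + 2) → (Fin (n + 1) → G) → ℝ) :
    -(nu A * (∑ z, F i.castSucc z ^ 2 + ∑ z, F j.succ z ^ 2)) ≤
      2 * (∑ y : Fin (n + 2) → G, if (List.ofFn y).prod ∈ A then
        ((-1) ^ (i.castSucc : ℕ) * F i.castSucc (fun l => y (i.castSucc.succAbove l))) *
        ((-1) ^ (j.succ : ℕ) * F j.succ (fun l => y (j.succ.succAbove l))) else 0) +
      ∑ w : Fin n → G,
        ((-1) ^ (j : ℕ) * ∑ g, F i.castSucc (Fin.insertNth (α := fun _ => G) j g w) +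
        (-1) ^ (i : ℕ) * ∑ g, F j.succ (Fin.insertNth (α := fun _ => G) i g w)) ^ 2 := by
  rw [sum_insertNth j (fun z => F i.castSucc z ^ 2), sum_insertNth i (fun z => F j.succ z ^ 2),
    sum_insertNth j.succ, sum_insertNth i, ← Finset.sum_add_distrib, Finset.mul_sum,
    Finset.mul_sum, ← Finset.sum_neg_distrib, ← Finset.sum_add_distrib]
  refine Finset.sum_le_sum fun w _ => ?_
  obtain ⟨P, Q, R, hP⟩ := exists_prod_insertNth_insertNth h w
  have hi : ((-1 : ℝ) ^ (i : ℕ)) ^ 2 = 1 := by rw [← pow_mul, mul_comm, pow_mul]; simp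
  have hj : ((-1 : ℝ) ^ (j : ℕ)) ^ 2 = 1 := by rw [← pow_mul, mul_comm, pow_mul]; simp
  have key := neg_nu_mul_le A P Q R
    (fun a => F j.succ (Fin.insertNth (α := fun _ => G) i a w))
    (fun b => F i.castSucc (Fin.insertNth (α := fun _ => G) j b w))
    ((-1) ^ (i : ℕ) * (-1) ^ (j : ℕ)) (by rw [mul_pow, hi, hj, one_mul])
  simp only [insertNth_comp_castSucc_succAbove h, hP, Fin.insertNth_apply_succAbove]
  have e1 : ∀ a b, (if P * a * Q * b * R ∈ A then
      ((-1 : ℝ) ^ (i.castSucc : ℕ) * F i.castSucc (Fin.insertNth (α := fun _ => G) j b w)) *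
        ((-1) ^ (j.succ : ℕ) * F j.succ (fun l => Fin.insertNth (α := fun _ => G) i a w l))
        else 0) = -((-1) ^ (i : ℕ) * (-1) ^ (j : ℕ)) * (if P * a * Q * b * R ∈ A then
        F j.succ (Fin.insertNth (α := fun _ => G) i a w) *
        F i.castSucc (Fin.insertNth (α := fun _ => G) j b w) else 0) := by
    intro a b
    rw [mul_ite, mul_zero]
    refine if_congr Iff.rfl ?_ rfl
    rw [Fin.val_castSucc, Fin.val_succ, pow_succ]
    ring
  simp only [e1, ← Finset.mul_sum]
  refine le_trans (le_of_eq (by ring)) (key.trans (le_of_eq ?_))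
  linear_combination (∑ b, F i.castSucc (Fin.insertNth (α := fun _ => G) j b w)) ^ 2 *
    ((-1 : ℝ) ^ (j : ℕ)) ^ 2 * hi - (∑ a, F j.succ (Fin.insertNth (α := fun _ => G) i a w)) ^ 2 * hi

/-- The spectral estimate, in coordinates: `F p` is the cochain on the simplices that miss the
color `p`. -/
theorem card_sub_nu_mul_le (A : Finset G) (F : Fin (n + 2) → (Fin (n + 1) → G) → ℝ) :
    ((A.card : ℝ) - (n + 1 : ℕ) * nu A) * ∑ p, ∑ z, F p z ^ 2 ≤
      ∑ t : LePair (n + 1), ∑ w : Fin n → G,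
        ((-1) ^ (t.1.2 : ℕ) *
          ∑ g, F t.1.1.castSucc (Fin.insertNth (α := fun _ => G) t.1.2 g w) +
        (-1) ^ (t.1.1 : ℕ) *
          ∑ g, F t.1.2.succ (Fin.insertNth (α := fun _ => G) t.1.1 g w)) ^ 2 +
      ∑ y : Fin (n + 2) → G, if (List.ofFn y).prod ∈ A then
        (∑ p : Fin (n + 2), (-1) ^ (p : ℕ) * F p (fun l => y (p.succAbove l))) ^ 2 else 0 := by
  have hpair := Finset.sum_le_sum fun (t : LePair (n + 1)) (_ : t ∈ Finset.univ) =>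
    neg_nu_mul_le_pair A t.2 F
  rw [Finset.sum_neg_distrib, ← Finset.mul_sum, sum_lePair_add (fun p => ∑ z, F p z ^ 2),
    Finset.sum_add_distrib, ← Finset.mul_sum] at hpair
  have hD : (∑ y : Fin (n + 2) → G, if (List.ofFn y).prod ∈ A then
        (∑ p : Fin (n + 2), (-1) ^ (p : ℕ) * F p (fun l => y (p.succAbove l))) ^ 2 else 0) =
      A.card * ∑ p, ∑ z, F p z ^ 2 +
      2 * ∑ t : LePair (n + 1), ∑ y : Fin (n + 2) → G, (if (List.ofFn y).prod ∈ A then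
        ((-1) ^ (t.1.1.castSucc : ℕ) *
          F t.1.1.castSucc (fun l => y (t.1.1.castSucc.succAbove l))) *
        ((-1) ^ (t.1.2.succ : ℕ) * F t.1.2.succ (fun l => y (t.1.2.succ.succAbove l)))
        else 0) := by
    rw [Finset.mul_sum, ← Finset.sum_congr rfl fun p _ => sum_sq_prod_mem A p (F p),
      Finset.sum_comm, Finset.sum_comm (s := (Finset.univ : Finset (LePair (n + 1)))),
      Finset.mul_sum, ← Finset.sum_add_distrib]
    refine Finset.sum_congr rfl fun y _ => ?_
    split_ifs
    · rw [sum_sq_eq_lePair]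
      congr 1
      refine Finset.sum_congr rfl fun p _ => ?_
      rw [mul_pow, ← pow_mul, mul_comm (p : ℕ), pow_mul]
      simp
    · simp
  rw [hD]
  linarith

end Tuples

/-! ### Simplices of the balanced Cayley complex -/

section Balanced

variable {G : Type*} [Group G] {A : Finset G} {k m n : ℕ}

/-- The ordered simplex with vertices `(c 0, w 0), …, (c (m - 1), w (m - 1))`. The condition says
that it is not of top dimension, or that it is a face of a simplex whose product lies in `A`. -/
def tupleSimplex (c : Fin m ↪ Fin (k + 1)) (w : Fin m → G)
    (h : m ≤ k ∨ ∃ y : Fin (k + 1) → G, (∀ l, w l = y (c l)) ∧ (List.ofFn y).prod ∈ A) :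
    OrderedSimplex (cayleyComplex A k) m :=
  ⟨⟨fun l => (c l, w l), fun _ _ hl => c.injective (congrArg Prod.fst hl)⟩, by
    refine (Nat.eq_zero_or_pos m).imp id fun hm => ?_
    have : Nonempty (Fin m) := ⟨⟨0, hm⟩⟩
    refine ⟨⟨Finset.univ_nonempty.map, ?_⟩, ?_⟩
    · intro x hx x' hx' hxx
      simp only [Finset.coe_map, Finset.coe_univ, Set.image_univ, Set.mem_range] at hx hx'
      obtain ⟨l, rfl⟩ := hx
      obtain ⟨l', rfl⟩ := hx'
      rw [c.injective hxx]
    · have hcard : (Finset.univ.map (⟨fun l => (c l, w l), fun _ _ hl =>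
          c.injective (congrArg Prod.fst hl)⟩ : Fin m ↪ Fin (k + 1) × G)).card = m := by simp
      rcases Nat.lt_or_ge k m with hkm | hkm
      · obtain ⟨y, hy, hA⟩ := h.resolve_left (not_le.2 hkm)
        refine Or.inr ⟨y, hA, ?_⟩
        have hle : m ≤ k + 1 := by simpa using Fintype.card_le_of_embedding c
        obtain rfl : m = k + 1 := by omega
        have hsurj : Function.Surjective c := Finite.surjective_of_injective c.injective
        ext x
        simp only [Finset.coe_map, Finset.coe_univ, Set.image_univ, Set.mem_range,
          Function.Embedding.coeFn_mk, hy]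
        exact (hsurj.exists (p := fun q => (q, y q) = x)).symm
      · exact Or.inl (hcard.trans_le hkm)⟩

theorem OrderedSimplex.ext_apply {V : Type*} {X : PreAbstractSimplicialComplex V}
    {σ τ : OrderedSimplex X m} (h : ∀ l, σ.1 l = τ.1 l) : σ = τ :=
  Subtype.ext (DFunLike.ext _ _ h)

theorem fst_injective (σ : OrderedSimplex (cayleyComplex A k) m) :
    Function.Injective fun l => (σ.1 l).1 := by
  intro l l' h
  rcases σ.2 with rfl | hσ
  · exact l.elim0
  · exact σ.1.injective (hσ.1.2 (Finset.mem_coe.2 (Finset.mem_map_of_mem _ (Finset.mem_univ l)))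
      (Finset.mem_coe.2 (Finset.mem_map_of_mem _ (Finset.mem_univ l'))) h)

/-- With the colors in increasing order, no two distinct tuples give reorderings of one another. -/
theorem tupleSimplex_reorder_injective {c c' : Fin m ↪ Fin (k + 1)} {w w' : Fin m → G}
    {h : m ≤ k ∨ ∃ y : Fin (k + 1) → G, (∀ l, w l = y (c l)) ∧ (List.ofFn y).prod ∈ A}
    {h' : m ≤ k ∨ ∃ y : Fin (k + 1) → G, (∀ l, w' l = y (c' l)) ∧ (List.ofFn y).prod ∈ A}
    (hc : StrictMono c) (hc' : StrictMono c') {π π' : Equiv.Perm (Fin m)}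
    (heq : (tupleSimplex c w h).reorder π = (tupleSimplex c' w' h').reorder π') :
    c = c' ∧ w = w' ∧ π = π' := by
  have h1 : ∀ l, (c (π l), w (π l)) = (c' (π' l), w' (π' l)) := fun l =>
    congrArg (fun σ : OrderedSimplex (cayleyComplex A k) m => σ.1 l) heq
  have hcc : c = c' := by
    refine DFunLike.coe_injective ((hc.range_inj hc').1 ?_)
    rw [← π.surjective.range_comp c, ← π'.surjective.range_comp c']
    exact congrArg Set.range (funext fun l => congrArg Prod.fst (h1 l))
  subst hcc
  have hππ : π = π' := by
    ext1 l
    exact c.injective (congrArg Prod.fst (h1 l))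
  subst hππ
  refine ⟨rfl, funext fun l => ?_, rfl⟩
  obtain ⟨l, rfl⟩ := π.surjective l
  exact congrArg Prod.snd (h1 l)

/-- The top simplex with vertices `(l, y l)`. -/
def topSimplex (y : {y : Fin (k + 1) → G // (List.ofFn y).prod ∈ A}) :
    OrderedSimplex (cayleyComplex A k) (k + 1) :=
  tupleSimplex (Function.Embedding.refl _) y.1 (Or.inr ⟨y.1, fun _ => rfl, y.2⟩)

/-- The simplex with all colors except `p`, and group elements `z`. -/
def facetSimplex (A : Finset G) (p : Fin (k + 1)) (z : Fin k → G) :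
    OrderedSimplex (cayleyComplex A k) k :=
  tupleSimplex p.succAboveEmb z (Or.inl le_rfl)

/-- The simplex with all colors except the two given by a pair, and group elements `w`. -/
def ridgeSimplex (A : Finset G) (t : LePair (n + 1)) (w : Fin n → G) :
    OrderedSimplex (cayleyComplex A (n + 1)) n :=
  tupleSimplex (t.1.2.succAboveEmb.trans t.1.1.castSucc.succAboveEmb) w (Or.inl n.le_succ)

theorem face_topSimplex (y : {y : Fin (k + 1) → G // (List.ofFn y).prod ∈ A}) (p : Fin (k + 1)) :
    (topSimplex y).face p = facetSimplex A p fun l => y.1 (p.succAbove l) := rfl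

theorem topSimplex_reorder_injective :
    Function.Injective fun p : {y : Fin (k + 1) → G // (List.ofFn y).prod ∈ A} ×
      Equiv.Perm (Fin (k + 1)) => (topSimplex p.1).reorder p.2 := by
  rintro ⟨y, π⟩ ⟨y', π'⟩ h
  obtain ⟨-, h1, h2⟩ := tupleSimplex_reorder_injective strictMono_id strictMono_id h
  exact Prod.ext (Subtype.ext h1) h2

theorem ridgeSimplex_reorder_injective :
    Function.Injective fun p : (LePair (n + 1) × (Fin n → G)) × Equiv.Perm (Fin n) =>
      (ridgeSimplex A p.1.1 p.1.2).reorder p.2 := by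
  rintro ⟨⟨t, w⟩, π⟩ ⟨⟨t', w'⟩, π'⟩ h
  obtain ⟨h0, h1, h2⟩ := tupleSimplex_reorder_injective
    ((Fin.strictMono_succAbove _).comp (Fin.strictMono_succAbove _))
    ((Fin.strictMono_succAbove _).comp (Fin.strictMono_succAbove _)) h
  refine Prod.ext (Prod.ext (lePair_eq_of_succAbove_eq fun l => ?_) h1) h2
  exact DFunLike.congr_fun h0 l

theorem facetSimplex_reorder_bijective :
    Function.Bijective fun p : (Fin (k + 1) × (Fin k → G)) × Equiv.Perm (Fin k) =>
      (facetSimplex A p.1.1 p.1.2).reorder p.2 := by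
  constructor
  · rintro ⟨⟨p, z⟩, π⟩ ⟨⟨p', z'⟩, π'⟩ h
    obtain ⟨h0, h1, h2⟩ := tupleSimplex_reorder_injective (Fin.strictMono_succAbove _)
      (Fin.strictMono_succAbove _) h
    refine Prod.ext (Prod.ext (Fin.succAbove_left_injective ?_) h1) h2
    exact funext fun l => DFunLike.congr_fun h0 l
  · intro σ
    have hinj := fst_injective σ
    obtain ⟨p, hp⟩ : ∃ p, ∀ l, (σ.1 l).1 ≠ p := by
      by_contra! hcon
      have := Fintype.card_le_of_surjective _ hcon
      simp at this
    choose f hf using fun l => Fin.exists_succAbove_eq (hp l)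
    have hfinj : Function.Injective f := fun l l' h => hinj (by
      change (σ.1 l).1 = (σ.1 l').1
      rw [← hf, ← hf, h])
    let π : Equiv.Perm (Fin k) := Equiv.ofBijective f (Finite.injective_iff_bijective.1 hfinj)
    refine ⟨((p, fun l => (σ.1 (π.symm l)).2), π), OrderedSimplex.ext_apply fun l => ?_⟩
    change (p.succAbove (f l), (σ.1 (π.symm (π l))).2) = _
    rw [hf, Equiv.symm_apply_apply]

/-- An ordered simplex is determined by its first vertex and the opposite face. -/
theorem OrderedSimplex.ext_face_zero {V : Type*} {X : PreAbstractSimplicialComplex V}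
    {σ τ : OrderedSimplex X (m + 1)} (h0 : σ.1 0 = τ.1 0) (h : σ.face 0 = τ.face 0) : σ = τ := by
  refine OrderedSimplex.ext_apply fun l => ?_
  refine Fin.cases h0 (fun l => ?_) l
  exact congrArg (fun ρ : OrderedSimplex X m => ρ.1 l) h

theorem face_zero_reorder_cycleRange_symm {V : Type*} {X : PreAbstractSimplicialComplex V}
    (σ : OrderedSimplex X (m + 1)) (i : Fin (m + 1)) :
    (σ.reorder i.cycleRange.symm).face 0 = σ.face i := by
  refine OrderedSimplex.ext_apply fun l => ?_
  change σ.1 (i.cycleRange.symm ((0 : Fin (m + 1)).succAbove l)) = σ.1 (i.succAbove l)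
  rw [Fin.succAbove_zero, Fin.cycleRange_symm_succ]

theorem Cochain.apply_reorder_cycleRange_symm {V : Type*} {X : PreAbstractSimplicialComplex V}
    (φ : Cochain X (m + 1)) (σ : OrderedSimplex X (m + 1)) (i : Fin (m + 1)) :
    φ (σ.reorder i.cycleRange.symm) = (-1) ^ (i : ℕ) * φ σ := by
  rw [φ.apply_reorder, Equiv.Perm.sign_symm, Fin.sign_cycleRange]
  simp

theorem face_facetSimplex_castSucc (t : LePair (n + 1)) (w : Fin n → G) (g : G) :
    (facetSimplex A t.1.1.castSucc (Fin.insertNth (α := fun _ => G) t.1.2 g w)).face t.1.2 =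
      ridgeSimplex A t w := by
  refine OrderedSimplex.ext_apply fun l => ?_
  refine Prod.ext rfl ?_
  exact Fin.insertNth_apply_succAbove (α := fun _ => G) _ _ _ _

theorem face_facetSimplex_succ (t : LePair (n + 1)) (w : Fin n → G) (g : G) :
    (facetSimplex A t.1.2.succ (Fin.insertNth (α := fun _ => G) t.1.1 g w)).face t.1.1 =
      ridgeSimplex A t w := by
  refine OrderedSimplex.ext_apply fun l => ?_
  refine Prod.ext (succAbove_succAbove_of_le t.2 l).symm ?_
  exact Fin.insertNth_apply_succAbove (α := fun _ => G) _ _ _ _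

variable [Fintype G]

/-- A simplex that misses two colors can be enlarged by any vertex of one of these colors. -/
theorem boundary_ridgeSimplex (φ : Cochain (cayleyComplex A (n + 1)) (n + 1))
    (t : LePair (n + 1)) (w : Fin n → G) :
    boundary φ (ridgeSimplex A t w) =
      (-1) ^ (t.1.2 : ℕ) * ∑ g, φ (facetSimplex A t.1.1.castSucc
        (Fin.insertNth (α := fun _ => G) t.1.2 g w)) +
      (-1) ^ (t.1.1 : ℕ) * ∑ g, φ (facetSimplex A t.1.2.succ
        (Fin.insertNth (α := fun _ => G) t.1.1 g w)) := by
  classical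
  let θ : G ⊕ G → OrderedSimplex (cayleyComplex A (n + 1)) (n + 1) := Sum.elim
    (fun g => (facetSimplex A t.1.1.castSucc
      (Fin.insertNth (α := fun _ => G) t.1.2 g w)).reorder t.1.2.cycleRange.symm)
    (fun g => (facetSimplex A t.1.2.succ
      (Fin.insertNth (α := fun _ => G) t.1.1 g w)).reorder t.1.1.cycleRange.symm)
  have hθf : ∀ x, (θ x).face 0 = ridgeSimplex A t w := by
    rintro (g | g)
    · exact (face_zero_reorder_cycleRange_symm _ _).trans (face_facetSimplex_castSucc t w g)
    · exact (face_zero_reorder_cycleRange_symm _ _).trans (face_facetSimplex_succ t w g)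
  have hl : ∀ g, (θ (Sum.inl g)).1 0 = (t.1.2.succ, g) := by
    intro g
    change (t.1.1.castSucc.succAbove (t.1.2.cycleRange.symm 0),
      Fin.insertNth (α := fun _ => G) t.1.2 g w (t.1.2.cycleRange.symm 0)) = _
    rw [Fin.cycleRange_symm_zero, castSucc_succAbove_of_le t.2, Fin.insertNth_apply_same]
  have hr : ∀ g, (θ (Sum.inr g)).1 0 = (t.1.1.castSucc, g) := by
    intro g
    change (t.1.2.succ.succAbove (t.1.1.cycleRange.symm 0),
      Fin.insertNth (α := fun _ => G) t.1.1 g w (t.1.1.cycleRange.symm 0)) = _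
    rw [Fin.cycleRange_symm_zero, succ_succAbove_of_le t.2, Fin.insertNth_apply_same]
  have hne : t.1.1.castSucc ≠ t.1.2.succ := (Fin.castSucc_lt_succ_iff.2 t.2).ne
  have hsum : ∑ x, φ (θ x) = boundary φ (ridgeSimplex A t w) := by
    rw [boundary_apply, ← Finset.sum_filter]
    refine Finset.sum_bij (fun x _ => θ x) (fun x _ => by simp [hθf]) ?_ ?_ (fun _ _ => rfl)
    · intro x _ x' _ h
      have h0 := congrArg (fun σ : OrderedSimplex (cayleyComplex A (n + 1)) (n + 1) => σ.1 0) h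
      rcases x with g | g <;> rcases x' with g' | g' <;>
        simp only [hl, hr, Prod.mk.injEq] at h0
      · rw [h0.2]
      · exact absurd h0.1.symm hne
      · exact absurd h0.1 hne
      · rw [h0.2]
    · intro σ hσ
      have hσ' : σ.face 0 = ridgeSimplex A t w := by simpa using hσ
      have hcol : ∀ l : Fin n, t.1.1.castSucc.succAbove (t.1.2.succAbove l) ≠ (σ.1 0).1 := by
        intro l hl
        have h1 : ((ridgeSimplex A t w).1 l).1 = (σ.1 0).1 := hl
        rw [← hσ'] at h1
        exact Fin.succ_ne_zero l (fst_injective σ h1)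
      rcases eq_or_eq_of_ne_succAbove t.2 _ hcol with h | h
      · refine ⟨Sum.inr (σ.1 0).2, Finset.mem_univ _, OrderedSimplex.ext_face_zero ?_ ?_⟩
        · rw [hr, ← h]
        · rw [hθf, hσ']
      · refine ⟨Sum.inl (σ.1 0).2, Finset.mem_univ _, OrderedSimplex.ext_face_zero ?_ ?_⟩
        · rw [hl, ← h]
        · rw [hθf, hσ']
  rw [← hsum, Fintype.sum_sum_type, Finset.mul_sum, Finset.mul_sum]
  congr 1
  · exact Finset.sum_congr rfl fun g _ => φ.apply_reorder_cycleRange_symm _ _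
  · exact Finset.sum_congr rfl fun g _ => φ.apply_reorder_cycleRange_symm _ _

/-- The tuple estimate, read through systems of representatives of the simplices of the three
dimensions involved. For the two outer dimensions an injective family suffices. -/
theorem card_sub_nu_mul_inner_le (A : Finset G)
    (φ : Cochain (cayleyComplex A (n + 1)) (n + 1)) :
    ((A.card : ℝ) - (n + 1 : ℕ) * nu A) * inner ℝ φ φ ≤ inner ℝ (boundary φ) (boundary φ) +
      inner ℝ (coboundary _ (n + 1) φ) (coboundary _ (n + 1) φ) := by
  classical
  have h := card_sub_nu_mul_le A fun p z => φ (facetSimplex A p z)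
  have h1 := sum_sq_le_inner_of_injective _ topSimplex_reorder_injective
    (coboundary _ (n + 1) φ)
  have h2 := sum_sq_le_inner_of_injective
    (fun x : LePair (n + 1) × (Fin n → G) => ridgeSimplex A x.1 x.2)
    ridgeSimplex_reorder_injective (boundary φ)
  have h3 := inner_eq_sum_of_bijective
    (fun x : Fin (n + 2) × (Fin (n + 1) → G) => facetSimplex A x.1 x.2)
    facetSimplex_reorder_bijective φ φ
  rw [Fintype.sum_prod_type] at h2 h3
  simp only [boundary_ridgeSimplex] at h2
  simp only [coboundary_apply, face_topSimplex] at h1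
  simp only [← sq] at h3
  rw [← Finset.sum_filter, Finset.sum_subtype (Finset.univ.filter _)
    fun y => Finset.mem_filter.trans (and_iff_right (Finset.mem_univ y))] at h
  rw [h3]
  exact h.trans (add_le_add h2 h1)

end Balanced

end CayleyComplex

theorem mainTheorem2 {G : Type*} [Group G] [Fintype G] (k : ℕ) (hk : 1 ≤ k)
    (A : Finset G) (hA : A.Nonempty) :
    (A.card : ℝ) - k * CayleyComplex.nu A ≤
      CayleyComplex.spectralGap (CayleyComplex.cayleyComplex A k) (k - 1) := by
  obtain ⟨n, rfl⟩ := Nat.exists_eq_add_of_le' hk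
  have := CayleyComplex.nontrivial_cochain (CayleyComplex.facetSimplex A (0 : Fin (n + 1 + 1)) 1)
  exact CayleyComplex.le_spectralGap_of_forall n _ (CayleyComplex.card_sub_nu_mul_inner_le A)
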